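/- Let the scalar field $\mathbb K$ be $\mathbb R$ or $\mathbb C$, let $1\le p<\infty$ and let $p'$ be the conjugate exponent, $\frac1p+\frac1{p'}=1$ ($p'=\infty$ if $p=1$). *Definitions.* For a finite family $(x_i)$ in a normed space let $\|(x_i)\|_r=(\sum_i\|x_i\|^r)^{1/r}$ (a maximum if $r=\infty$) and $\|(x_i)\|^w_r=\sup_{\|\varphi\|\le1}\|(\varphi(x_i))\|_r$. For $z\in E\otimes F$ put $$d_r(z)=\inf\|(x_i)\|^w_{r'}\,\|(y_i)\|_r,\qquad g_r(z)=\inf\|(x_i)\|_r\,\|(y_i)\|^w_{r'},$$ the infima being over all finite representations $z=\sum_i x_i\otimes y_i$. A tensor norm $\alpha$ is an assignment of a norm to each $E\otimes F$ ($E,F$ normed spaces) with $\varepsilon\le\alpha\le\pi$ (injective and projective norms) and $\alpha((S\otimes T)z)\le\|S\|\|T\|\alpha(z)$. It is left injective if $\alpha((I\otimes \mathrm{id}_F)z)=\alpha(z)$ for all linear isometric embeddings $I:E\to G$, and finitely generated if $\alpha(z;E,F)=\inf\alpha(z;M,N)$ over all finite-dimensional subspaces $M\subset E$, $N\subset F$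 with $z\in M\otimes N$. The norm $/\alpha$ on $E\otimes F$ is the one induced by $\alpha$ on $\ell_\infty(B_{E'})\otimes F$ via the canonical embedding $E\hookrightarrow\ell_\infty(B_{E'})$. The dual tensor norm $\alpha'$ is defined, for finite-dimensional $M,N$, by $M\otimes_{\alpha'}N=(M'\otimes_\alpha N')'$ isometrically, and in general by $\alpha'(z;E,F)=\inf\alpha'(z;M,N)$ over finite-dimensional subspaces $M\subset E$, $N\subset F$ with $z\in M\otimes N$. For Banach spaces $E,F$, an operator $T\in\mathcal L(E;F)$ is $p$-compact, $T\in\mathcal K_p(E;F)$, if there is $(y_n)\in\ell_p(F)$ with $T(B_E)\subset p\text{-}\mathrm{co}\{y_n\}:=\{\sum_n a_ny_n:(a_n)\in B_{\ell_{p'}}\}$ ($\ell_{p'}$ replaced by $c_0$ if $p=1$), and $\kappa_p(T)$ is the infimum of $\|(y_n)\|_p$ over all such sequences. A Banach operator ideal $(\mathcal A,a)$ is associated to a tensor norm $\alpha$ if, for all finite-dimensional $M,N$, the canonical map $M'\otimes_\alpha N\to\mathcal A(M;N)$ is an isometric isomorphism. **Theorem.** For every $1\le p<\infty$: 1. $(\mathcal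 K_p,\kappa_p)$ is a Banach operator ideal; 2. $/d_p$ is the left injective associate of $d_p$, i.e. it is a left injective tensor norm with $/d_p\le d_p$ and it is the greatest such; moreover it is finitely generated; 3. $(\mathcal K_p,\kappa_p)$ is associated to $/d_p$: for all finite-dimensional $M,N$, $\mathcal K_p(M;N)=M'\otimes_{/d_p}N$ isometrically via the canonical map; 4. $/d_p=g_{p'}'$ on $E\otimes F$ for all normed spaces $E,F$. -/

import Mathlib

open scoped ENNReal TensorProduct Topology

universe u

noncomputable section

/-! ### Norms of finite families -/

/-- The strong norm `‖(x_i)‖_r` of a finite family: `(∑ ‖x_i‖ ^ r) ^ (1 / r)` for `r < ∞`,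
and `max ‖x_i‖` for `r = ∞`. -/
def strongNorm {E : Type u} [NormedAddCommGroup E] (r : ℝ≥0∞) {n : ℕ} (x : Fin n → E) : ℝ :=
  ‖(WithLp.toLp r x : PiLp r (fun _ : Fin n => E))‖

/-- The weak norm of a finite family: the supremum over `φ` in the closed unit ball of the dual
of the `ℓ_r` norm of the scalar family `(φ (x_i))`. -/
def weakNorm (𝕜 : Type) [RCLike 𝕜] {E : Type u} [NormedAddCommGroup E] [NormedSpace 𝕜 E]
    (r : ℝ≥0∞) {n : ℕ} (x : Fin n → E) : ℝ :=
  sSup {c : ℝ | ∃ φ : StrongDual 𝕜 E, ‖φ‖ ≤ 1 ∧ c = strongNorm r (fun i => φ (x i))}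

/-! ### Tensor norms -/

/-- A family of real-valued functions, one on each algebraic tensor product `E ⊗ F` of normed
spaces. -/
abbrev TensorFamily (𝕜 : Type) [RCLike 𝕜] : Type (u + 1) :=
  ∀ (E F : Type u) [NormedAddCommGroup E] [NormedSpace 𝕜 E]
    [NormedAddCommGroup F] [NormedSpace 𝕜 F], E ⊗[𝕜] F → ℝ

/-- The order on families: `α ≤ β` on every tensor product. -/
def TensorFamily.Le {𝕜 : Type} [RCLike 𝕜] (α β : TensorFamily.{u} 𝕜) : Prop :=
  ∀ (E F : Type u) [NormedAddCommGroup E] [NormedSpace 𝕜 E]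
    [NormedAddCommGroup F] [NormedSpace 𝕜 F] (z : E ⊗[𝕜] F), α E F z ≤ β E F z

/-- The canonical pairing of `E ⊗ F` with `E' ⊗ F'`: it sends `x ⊗ y` and `φ ⊗ ψ` to
`φ x * ψ y`. -/
def tensorPairing (𝕜 : Type) [RCLike 𝕜] (E F : Type u)
    [NormedAddCommGroup E] [NormedSpace 𝕜 E] [NormedAddCommGroup F] [NormedSpace 𝕜 F]
    (z : E ⊗[𝕜] F) (w : StrongDual 𝕜 E ⊗[𝕜] StrongDual 𝕜 F) : 𝕜 :=
  TensorProduct.dualDistrib 𝕜 E F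
    (TensorProduct.map (ContinuousLinearMap.coeLM 𝕜) (ContinuousLinearMap.coeLM 𝕜) w) z

/-- A tensor norm: a norm on every tensor product of normed spaces which lies between the
injective norm (`injective_le`) and the projective norm (`tmul_le`), and has the metric mapping
property. -/
structure IsTensorNorm {𝕜 : Type} [RCLike 𝕜] (α : TensorFamily.{u} 𝕜) : Prop where
  add_le : ∀ (E F : Type u) [NormedAddCommGroup E] [NormedSpace 𝕜 E]
    [NormedAddCommGroup F] [NormedSpace 𝕜 F] (z w : E ⊗[𝕜] F),
    α E F (z + w) ≤ α E F z + α E F w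
  smul_eq : ∀ (E F : Type u) [NormedAddCommGroup E] [NormedSpace 𝕜 E]
    [NormedAddCommGroup F] [NormedSpace 𝕜 F] (c : 𝕜) (z : E ⊗[𝕜] F),
    α E F (c • z) = ‖c‖ * α E F z
  eq_zero : ∀ (E F : Type u) [NormedAddCommGroup E] [NormedSpace 𝕜 E]
    [NormedAddCommGroup F] [NormedSpace 𝕜 F] (z : E ⊗[𝕜] F), α E F z = 0 → z = 0
  tmul_le : ∀ (E F : Type u) [NormedAddCommGroup E] [NormedSpace 𝕜 E]
    [NormedAddCommGroup F] [NormedSpace 𝕜 F] (x : E) (y : F),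
    α E F (x ⊗ₜ[𝕜] y) ≤ ‖x‖ * ‖y‖
  injective_le : ∀ (E F : Type u) [NormedAddCommGroup E] [NormedSpace 𝕜 E]
    [NormedAddCommGroup F] [NormedSpace 𝕜 F] (z : E ⊗[𝕜] F)
    (φ : StrongDual 𝕜 E) (ψ : StrongDual 𝕜 F), ‖φ‖ ≤ 1 → ‖ψ‖ ≤ 1 →
    ‖tensorPairing 𝕜 E F z (φ ⊗ₜ[𝕜] ψ)‖ ≤ α E F z
  map_le : ∀ (E F G H : Type u) [NormedAddCommGroup E] [NormedSpace 𝕜 E]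
    [NormedAddCommGroup F] [NormedSpace 𝕜 F] [NormedAddCommGroup G] [NormedSpace 𝕜 G]
    [NormedAddCommGroup H] [NormedSpace 𝕜 H] (S : E →L[𝕜] G) (T : F →L[𝕜] H) (z : E ⊗[𝕜] F),
    α G H (TensorProduct.map S.toLinearMap T.toLinearMap z) ≤ ‖S‖ * ‖T‖ * α E F z

/-- The finite hull of a family: the infimum of the values of the family on `M ⊗ N`, over all
finite-dimensional subspaces `M`, `N` such that the tensor comes from `M ⊗ N`. -/
def finiteHull {𝕜 : Type} [RCLike 𝕜] (α : TensorFamily.{u} 𝕜) : TensorFamily.{u} 𝕜 :=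
  fun E F _ _ _ _ z =>
    sInf {c : ℝ | ∃ (M : Submodule 𝕜 E) (N : Submodule 𝕜 F) (w : M ⊗[𝕜] N),
      FiniteDimensional 𝕜 M ∧ FiniteDimensional 𝕜 N ∧
      TensorProduct.map M.subtype N.subtype w = z ∧ c = α M N w}

/-- A family is finitely generated if it is its own finite hull. -/
def IsFinitelyGenerated {𝕜 : Type} [RCLike 𝕜] (α : TensorFamily.{u} 𝕜) : Prop :=
  ∀ (E F : Type u) [NormedAddCommGroup E] [NormedSpace 𝕜 E]
    [NormedAddCommGroup F] [NormedSpace 𝕜 F] (z : E ⊗[𝕜] F), α E F z = finiteHull α E F z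

/-- The dual norm of a tensor with respect to the trace duality of `E ⊗ F` and `E' ⊗ F'`.
It is only used for finite-dimensional `E` and `F`, where the supremum is finite as soon as
`α` is a tensor norm. -/
def traceDual {𝕜 : Type} [RCLike 𝕜] (α : TensorFamily.{u} 𝕜) : TensorFamily.{u} 𝕜 :=
  fun E F _ _ _ _ z =>
    sSup {c : ℝ | ∃ w : StrongDual 𝕜 E ⊗[𝕜] StrongDual 𝕜 F,
      α (StrongDual 𝕜 E) (StrongDual 𝕜 F) w ≤ 1 ∧ c = ‖tensorPairing 𝕜 E F z w‖}

/-- The dual tensor norm: on `M ⊗ N` with `M`, `N` finite-dimensional it is the norm of the dual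
of `M' ⊗ N'` with the norm `α`, and it is extended to all normed spaces as a finite hull. -/
def dualTensorNorm {𝕜 : Type} [RCLike 𝕜] (α : TensorFamily.{u} 𝕜) : TensorFamily.{u} 𝕜 :=
  finiteHull (traceDual α)

/-- Left injectivity: isometric embeddings in the left factor induce isometric embeddings of
tensor products. -/
def IsLeftInjective {𝕜 : Type} [RCLike 𝕜] (α : TensorFamily.{u} 𝕜) : Prop :=
  ∀ (E G F : Type u) [NormedAddCommGroup E] [NormedSpace 𝕜 E]
    [NormedAddCommGroup G] [NormedSpace 𝕜 G] [NormedAddCommGroup F] [NormedSpace 𝕜 F]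
    (I : E →ₗᵢ[𝕜] G) (z : E ⊗[𝕜] F),
    α G F (TensorProduct.map I.toLinearMap LinearMap.id z) = α E F z

/-- `β` is the left injective associate of `α`: the greatest left injective tensor norm that is
dominated by `α`. -/
structure IsLeftInjectiveAssociate {𝕜 : Type} [RCLike 𝕜] (β α : TensorFamily.{u} 𝕜) : Prop where
  isTensorNorm : IsTensorNorm β
  isLeftInjective : IsLeftInjective β
  le : TensorFamily.Le β α
  greatest : ∀ γ : TensorFamily.{u} 𝕜, IsTensorNorm γ → IsLeftInjective γ →
    TensorFamily.Le γ α → TensorFamily.Le γ β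

/-- The space `ℓ_∞(B_{E'})` of bounded scalar functions on the closed unit ball of the dual,
with the supremum norm. -/
abbrev LinftyDualBall (𝕜 : Type) [RCLike 𝕜] (E : Type u) [NormedAddCommGroup E]
    [NormedSpace 𝕜 E] : Type u :=
  lp (fun _ : Metric.closedBall (0 : StrongDual 𝕜 E) 1 => 𝕜) ∞

/-- The canonical isometric embedding of `E` into `ℓ_∞(B_{E'})`, evaluation at `x`. -/
def evalEmbedding (𝕜 : Type) [RCLike 𝕜] (E : Type u) [NormedAddCommGroup E]
    [NormedSpace 𝕜 E] : E →ₗ[𝕜] LinftyDualBall 𝕜 E where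
  toFun x := ⟨fun φ => (φ : StrongDual 𝕜 E) x, memℓp_infty ⟨‖x‖, by
    rintro _ ⟨φ, rfl⟩
    have h : ‖(φ : StrongDual 𝕜 E)‖ ≤ 1 := mem_closedBall_zero_iff.mp φ.2
    simpa using (φ : StrongDual 𝕜 E).le_of_opNorm_le h x⟩⟩
  map_add' x y := by
    ext φ
    exact map_add (φ : StrongDual 𝕜 E) x y
  map_smul' c x := by
    ext φ
    exact map_smul (φ : StrongDual 𝕜 E) c x

/-- The norm `/α`: the norm on `E ⊗ F` induced by `α` on `ℓ_∞(B_{E'}) ⊗ F`. -/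
def leftInjectiveAssociate {𝕜 : Type} [RCLike 𝕜] (α : TensorFamily.{u} 𝕜) :
    TensorFamily.{u} 𝕜 :=
  fun E F _ _ _ _ z =>
    α (LinftyDualBall 𝕜 E) F (TensorProduct.map (evalEmbedding 𝕜 E) LinearMap.id z)

/-- The Chevet-Saphar norm `d_r`, with the weak norm for the conjugate exponent on the left and
the strong `r`-norm on the right. -/
def chevetSapharD (𝕜 : Type) [RCLike 𝕜] (r : ℝ≥0∞) : TensorFamily.{u} 𝕜 :=
  fun E F _ _ _ _ z =>
    sInf {c : ℝ | ∃ (n : ℕ) (x : Fin n → E) (y : Fin n → F),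
      z = ∑ i, x i ⊗ₜ[𝕜] y i ∧
      c = weakNorm 𝕜 (ENNReal.conjExponent r) x * strongNorm r y}

/-- The Chevet-Saphar norm `g_r`, with the strong `r`-norm on the left and the weak norm for the
conjugate exponent on the right. -/
def chevetSapharG (𝕜 : Type) [RCLike 𝕜] (r : ℝ≥0∞) : TensorFamily.{u} 𝕜 :=
  fun E F _ _ _ _ z =>
    sInf {c : ℝ | ∃ (n : ℕ) (x : Fin n → E) (y : Fin n → F),
      z = ∑ i, x i ⊗ₜ[𝕜] y i ∧
      c = strongNorm r x * weakNorm 𝕜 (ENNReal.conjExponent r) y}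

/-! ### Operator ideals -/

/-- A class of operators between normed spaces (used between Banach spaces only). -/
abbrev OperatorClass (𝕜 : Type) [RCLike 𝕜] : Type (u + 1) :=
  ∀ (E F : Type u) [NormedAddCommGroup E] [NormedSpace 𝕜 E]
    [NormedAddCommGroup F] [NormedSpace 𝕜 F], Set (E →L[𝕜] F)

/-- A real-valued function of operators. -/
abbrev OperatorFunction (𝕜 : Type) [RCLike 𝕜] : Type (u + 1) :=
  ∀ (E F : Type u) [NormedAddCommGroup E] [NormedSpace 𝕜 E]
    [NormedAddCommGroup F] [NormedSpace 𝕜 F], (E →L[𝕜] F) → ℝ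

/-- A Banach operator ideal: for all Banach spaces `E`, `F` the component `A E F` is a linear
subspace, containing the rank one operators, on which `a` is a complete norm with
`a (x' ⊗ y) = ‖x'‖ * ‖y‖`, and the ideal property holds with the ideal norm inequality. -/
structure IsBanachOperatorIdeal {𝕜 : Type} [RCLike 𝕜] (A : OperatorClass.{u} 𝕜)
    (a : OperatorFunction.{u} 𝕜) : Prop where
  rank_one : ∀ (E F : Type u) [NormedAddCommGroup E] [NormedSpace 𝕜 E] [CompleteSpace E]
    [NormedAddCommGroup F] [NormedSpace 𝕜 F] [CompleteSpace F] (φ : StrongDual 𝕜 E) (y : F),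
    φ.smulRight y ∈ A E F ∧ a E F (φ.smulRight y) = ‖φ‖ * ‖y‖
  add_mem : ∀ (E F : Type u) [NormedAddCommGroup E] [NormedSpace 𝕜 E] [CompleteSpace E]
    [NormedAddCommGroup F] [NormedSpace 𝕜 F] [CompleteSpace F] (S T : E →L[𝕜] F),
    S ∈ A E F → T ∈ A E F → S + T ∈ A E F ∧ a E F (S + T) ≤ a E F S + a E F T
  smul_mem : ∀ (E F : Type u) [NormedAddCommGroup E] [NormedSpace 𝕜 E] [CompleteSpace E]
    [NormedAddCommGroup F] [NormedSpace 𝕜 F] [CompleteSpace F] (c : 𝕜) (T : E →L[𝕜] F),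
    T ∈ A E F → c • T ∈ A E F ∧ a E F (c • T) = ‖c‖ * a E F T
  eq_zero : ∀ (E F : Type u) [NormedAddCommGroup E] [NormedSpace 𝕜 E] [CompleteSpace E]
    [NormedAddCommGroup F] [NormedSpace 𝕜 F] [CompleteSpace F] (T : E →L[𝕜] F),
    T ∈ A E F → a E F T = 0 → T = 0
  comp_mem : ∀ (D E F G : Type u) [NormedAddCommGroup D] [NormedSpace 𝕜 D] [CompleteSpace D]
    [NormedAddCommGroup E] [NormedSpace 𝕜 E] [CompleteSpace E]
    [NormedAddCommGroup F] [NormedSpace 𝕜 F] [CompleteSpace F]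
    [NormedAddCommGroup G] [NormedSpace 𝕜 G] [CompleteSpace G]
    (R : D →L[𝕜] E) (T : E →L[𝕜] F) (S : F →L[𝕜] G), T ∈ A E F →
    S.comp (T.comp R) ∈ A D G ∧ a D G (S.comp (T.comp R)) ≤ ‖S‖ * a E F T * ‖R‖
  complete : ∀ (E F : Type u) [NormedAddCommGroup E] [NormedSpace 𝕜 E] [CompleteSpace E]
    [NormedAddCommGroup F] [NormedSpace 𝕜 F] [CompleteSpace F] (T : ℕ → E →L[𝕜] F),
    (∀ n, T n ∈ A E F) →
    (∀ ε : ℝ, 0 < ε → ∃ k : ℕ, ∀ m n : ℕ, k ≤ m → k ≤ n → a E F (T m - T n) < ε) →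
    ∃ T₀ ∈ A E F, Filter.Tendsto (fun n => a E F (T n - T₀)) Filter.atTop (𝓝 0)

/-- The `p`-convex hull of a sequence in `ℓ_p(F)`: all sums `∑ α_n x_n` with coefficients in the
closed unit ball of `ℓ_q`, where `q` is the conjugate exponent of `p`; for `p = 1` the space
`ℓ_∞` is replaced by `c_0`. -/
def pConvexHull (𝕜 : Type) [RCLike 𝕜] (p : ℝ≥0∞) {F : Type u} [NormedAddCommGroup F]
    [NormedSpace 𝕜 F] (x : lp (fun _ : ℕ => F) p) : Set F :=
  {y : F | ∃ c : lp (fun _ : ℕ => 𝕜) (ENNReal.conjExponent p), ‖c‖ ≤ 1 ∧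
    (p = 1 → Filter.Tendsto (fun n => c n) Filter.atTop (𝓝 0)) ∧
    HasSum (fun n => c n • x n) y}

/-- The class `K_p` of `p`-compact operators, `1 ≤ p < ∞`: the image of the closed unit ball is
relatively `p`-compact, that is, contained in the `p`-convex hull of a sequence in `ℓ_p(F)`. -/
def pCompactOperators (𝕜 : Type) [RCLike 𝕜] (p : ℝ≥0∞) : OperatorClass.{u} 𝕜 :=
  fun E F _ _ _ _ => {T : E →L[𝕜] F | ∃ x : lp (fun _ : ℕ => F) p,
    T '' Metric.closedBall (0 : E) 1 ⊆ pConvexHull 𝕜 p x}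

/-- The norm `κ_p` on the class of `p`-compact operators (a junk value outside this class). -/
def kappa (𝕜 : Type) [RCLike 𝕜] (p : ℝ≥0∞) : OperatorFunction.{u} 𝕜 :=
  fun E F _ _ _ _ T => sInf {c : ℝ | ∃ x : lp (fun _ : ℕ => F) p,
    T '' Metric.closedBall (0 : E) 1 ⊆ pConvexHull 𝕜 p x ∧ c = ‖x‖}

/-- The canonical map from `E' ⊗ F` to the bounded operators, which sends `x' ⊗ y` to the
operator `x ↦ x'(x) y`. -/
def tensorToOperator (𝕜 : Type) [RCLike 𝕜] (E F : Type u)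
    [NormedAddCommGroup E] [NormedSpace 𝕜 E] [NormedAddCommGroup F] [NormedSpace 𝕜 F] :
    StrongDual 𝕜 E ⊗[𝕜] F →ₗ[𝕜] (E →L[𝕜] F) :=
  TensorProduct.lift (LinearMap.mk₂ 𝕜 (fun (φ : StrongDual 𝕜 E) (y : F) => φ.smulRight y)
    (fun φ ψ y => by ext x; simp [add_smul])
    (fun c φ y => by ext x; simp [mul_smul])
    (fun φ y z => by ext x; simp)
    (fun c φ y => by ext x; simp [smul_comm c]))

/-- The operator ideal `(A, a)` is associated to the family `α`: for all finite-dimensional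
`M` and `N`, the canonical map is an isometric isomorphism of `M' ⊗ N` with the norm `α` onto
`A M N` with the norm `a`. -/
def IsAssociated {𝕜 : Type} [RCLike 𝕜] (A : OperatorClass.{u} 𝕜) (a : OperatorFunction.{u} 𝕜)
    (α : TensorFamily.{u} 𝕜) : Prop :=
  ∀ (M N : Type u) [NormedAddCommGroup M] [NormedSpace 𝕜 M] [FiniteDimensional 𝕜 M]
    [NormedAddCommGroup N] [NormedSpace 𝕜 N] [FiniteDimensional 𝕜 N],
    Set.BijOn (tensorToOperator 𝕜 M N) Set.univ (A M N) ∧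
    ∀ z : StrongDual 𝕜 M ⊗[𝕜] N,
      a M N (tensorToOperator 𝕜 M N z) = α (StrongDual 𝕜 M) N z

end

/-!
# The ideal of `p`-compact operators and the tensor norm `/d_p`

Write `q` for the conjugate exponent of `p`.

*The norm `d_p`.* A representation of `z` can be rescaled so that its weak `ℓ_q` norm and its
strong `ℓ_p` norm are at most `t ^ (1 / q)` and `t ^ (1 / p)`, for any `t` above the product of the
two. Concatenating two representations rescaled in this way gives the triangle inequality, so
`d_p` is a tensor norm (`isTensorNorm_chevetSapharD`).

*Left injective hull.* A contraction `S : E → G` induces a composition map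
`ℓ_∞(B_{E'}) → ℓ_∞(B_{G'})`, and, when `S` is isometric, a Hahn-Banach choice of norm-preserving
extensions of functionals induces a map in the opposite direction. Both are compatible with the
canonical embeddings, so the metric mapping property of `α` makes `/α` a left injective tensor
norm, and the greatest one below `α`. Finite generation of `/d_p` uses left injectivity, together
with the fact that one representation involves only finitely many vectors of the right factor.

*The equality `/d_p = g_q'`.* The inequality `g_q' ≤ /d_p` is Hölder's inequality for a double sum
(`norm_tensorPairing_le_mul`). For the converse, Hahn-Banach yields a functional on
`ℓ_∞(B_{M'}) ⊗ N` dominated by `d_p` that attains `/d_p z`; on finitely many points, a `δ`-net of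
the ball, Pietsch's factorization theorem (a separation argument in `ℝ^ι`) writes it as a tensor
in `M' ⊗ N'` whose `g_q` norm is nearly at most one.

*The ideal.* The predicate `BallCoveredBy` replaces membership of `T(B_E)` in a `p`-convex hull by
families over arbitrary countable index sets. Sums of operators then correspond to concatenation
of rescaled families, and completeness follows by concatenating the families of a
fast converging series along `ℕ × ℕ`.

*Association.* For finite-dimensional `M`, reflexivity identifies the points of the ball of `M''`
with those of the ball of `M`. A representation of the image of `z` in `ℓ_∞(B_{M''}) ⊗ N` is then
the same as a family covering the image of the ball of `M` under the operator of `z`, except that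
covering families may be infinite. Their tails are small, because on `ℓ_∞(S) ⊗ N` every tensor norm
is dominated by a multiple of the supremum norm (`IsTensorNorm.exists_le_mul_of_leftSlice_le`).
-/

/-! ### `ℓ_r` bounds for families over arbitrary index types -/

/-- `LpBound r C f` says that the family `f`, over an arbitrary index type, has `ℓ_r` norm at most
`C`. It is phrased through finite partial sums, so that finite and infinite families are treated
alike and no summability has to be carried around. -/
def LpBound {ι E : Type*} [NormedAddCommGroup E] (r : ℝ≥0∞) (C : ℝ) (f : ι → E) : Prop :=
  (r = ∞ → ∀ i, ‖f i‖ ≤ C) ∧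
    (r ≠ ∞ → ∀ s : Finset ι, ∑ i ∈ s, ‖f i‖ ^ r.toReal ≤ C ^ r.toReal)

section LpBound

variable {ι κ E F : Type*} [NormedAddCommGroup E] [NormedAddCommGroup F] {r : ℝ≥0∞} {C D : ℝ}

theorem toReal_pos_of_one_le (hr : 1 ≤ r) (h : r ≠ ∞) : 0 < r.toReal :=
  ENNReal.toReal_pos (zero_lt_one.trans_le hr).ne' h

theorem one_le_toReal_of_one_le (hr : 1 ≤ r) (h : r ≠ ∞) : 1 ≤ r.toReal := by
  simpa using ENNReal.toReal_mono h hr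

theorem lpBound_top {f : ι → E} : LpBound ∞ C f ↔ ∀ i, ‖f i‖ ≤ C := by
  simp [LpBound]

theorem lpBound_of_ne_top (h : r ≠ ∞) {f : ι → E} :
    LpBound r C f ↔ ∀ s : Finset ι, ∑ i ∈ s, ‖f i‖ ^ r.toReal ≤ C ^ r.toReal := by
  simp [LpBound, h]

theorem lpBound_one {f : ι → E} :
    LpBound 1 C f ↔ ∀ s : Finset ι, ∑ i ∈ s, ‖f i‖ ≤ C := by
  simp [lpBound_of_ne_top]

theorem lpBound_iff_univ [Fintype ι] (h : r ≠ ∞) {f : ι → E} :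
    LpBound r C f ↔ ∑ i, ‖f i‖ ^ r.toReal ≤ C ^ r.toReal := by
  rw [lpBound_of_ne_top h]
  refine ⟨fun h => h _, fun h s => le_trans ?_ h⟩
  exact Finset.sum_le_sum_of_subset_of_nonneg (Finset.subset_univ s) fun _ _ _ => by positivity

theorem LpBound.norm_le (hr : 1 ≤ r) (hC : 0 ≤ C) {f : ι → E} (h : LpBound r C f) (i : ι) :
    ‖f i‖ ≤ C := by
  rcases eq_or_ne r ∞ with rfl | h'
  · exact lpBound_top.1 h i
  · have := (lpBound_of_ne_top h').1 h {i}
    rw [Finset.sum_singleton] at this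
    exact (Real.rpow_le_rpow_iff (norm_nonneg _) hC (toReal_pos_of_one_le hr h')).1 this

theorem LpBound.mono {f : ι → E} {g : ι → F} (hC : 0 ≤ C) (hCD : C ≤ D) (h : LpBound r C f)
    (hfg : ∀ i, ‖g i‖ ≤ ‖f i‖) : LpBound r D g := by
  refine ⟨fun h' i => (hfg i).trans ((h.1 h' i).trans hCD), fun h' s => ?_⟩
  refine le_trans (Finset.sum_le_sum fun i _ => ?_) ((h.2 h' s).trans ?_)
  · exact Real.rpow_le_rpow (norm_nonneg _) (hfg i) ENNReal.toReal_nonneg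
  · exact Real.rpow_le_rpow hC hCD ENNReal.toReal_nonneg

theorem LpBound.mul_left {f : ι → E} {g : ι → F} (hC : 0 ≤ C) (hD : 0 ≤ D) (h : LpBound r C f)
    (hfg : ∀ i, ‖g i‖ ≤ D * ‖f i‖) : LpBound r (D * C) g := by
  refine ⟨fun h' i => (hfg i).trans (mul_le_mul_of_nonneg_left (h.1 h' i) hD), fun h' s => ?_⟩
  rw [Real.mul_rpow hD hC]
  refine le_trans ?_ (mul_le_mul_of_nonneg_left (h.2 h' s) (Real.rpow_nonneg hD _))
  rw [Finset.mul_sum]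
  refine Finset.sum_le_sum fun i _ => ?_
  rw [← Real.mul_rpow hD (norm_nonneg _)]
  exact Real.rpow_le_rpow (norm_nonneg _) (hfg i) ENNReal.toReal_nonneg

theorem LpBound.comp_injective {f : ι → E} (h : LpBound r C f) {e : κ → ι}
    (he : Function.Injective e) : LpBound r C (f ∘ e) := by
  refine ⟨fun h' i => h.1 h' _, fun h' s => ?_⟩
  simpa using h.2 h' (s.map ⟨e, he⟩)

theorem LpBound.extend (hr : 1 ≤ r) {f : ι → E} (hC : 0 ≤ C) (h : LpBound r C f) {e : ι → κ}
    (he : Function.Injective e) : LpBound r C (Function.extend e f 0) := by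
  classical
  refine ⟨fun h' i => ?_, fun h' s => ?_⟩
  · by_cases hi : ∃ j, e j = i
    · obtain ⟨j, rfl⟩ := hi
      rw [he.extend_apply]
      exact h.1 h' j
    · rw [Function.extend_apply' _ _ _ hi]
      simpa using hC
  · refine le_trans (le_of_eq ?_) (h.2 h' (s.preimage e he.injOn))
    rw [← Finset.sum_preimage e s he.injOn]
    · exact Finset.sum_congr rfl fun i _ => by rw [he.extend_apply]
    · intro x _ hx
      rw [Function.extend_apply' _ _ _ (by simpa using hx)]
      simp [(toReal_pos_of_one_le hr h').ne']

/-- `ℓ_r` norms of concatenated families. The `r`-th powers add up; for `r = ∞` the exponent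
`r.toReal⁻¹` is `0`, so that all three bounds are `1`. -/
theorem LpBound.sumElim (hr : 1 ≤ r) {f : ι → E} {g : κ → E} {s t : ℝ} (hs : 0 ≤ s) (ht : 0 ≤ t)
    (hf : LpBound r (s ^ r.toReal⁻¹) f) (hg : LpBound r (t ^ r.toReal⁻¹) g) :
    LpBound r ((s + t) ^ r.toReal⁻¹) (Sum.elim f g) := by
  refine ⟨fun h' i => ?_, fun h' u => ?_⟩
  · subst h'
    have hf := lpBound_top.1 hf
    have hg := lpBound_top.1 hg
    simp only [ENNReal.toReal_top, inv_zero, Real.rpow_zero] at *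
    rcases i with i | i
    · exact hf i
    · exact hg i
  · have h0 := (toReal_pos_of_one_le hr h').ne'
    have hf := hf.2 h' u.toLeft
    have hg := hg.2 h' u.toRight
    rw [Real.rpow_inv_rpow hs h0] at hf
    rw [Real.rpow_inv_rpow ht h0] at hg
    rw [Real.rpow_inv_rpow (add_nonneg hs ht) h0, ← Finset.toLeft_disjSum_toRight (u := u),
      Finset.sum_disjSum]
    exact add_le_add hf hg

/-- Mixed `ℓ_r(ℓ_r)` bound for a doubly indexed family. -/
theorem LpBound.prod {G : Type*} [NormedAddCommGroup G] {f : ι × κ → E} {g : ι → F}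
    {h : ι → κ → G} (hC : 0 ≤ C) (hD : 0 ≤ D)
    (hg : LpBound r C g) (hh : ∀ i, LpBound r D (h i))
    (hf : ∀ i j, ‖f (i, j)‖ ≤ ‖g i‖ * ‖h i j‖) : LpBound r (C * D) f := by
  classical
  refine ⟨fun h' i => ?_, fun h' s => ?_⟩
  · exact (hf i.1 i.2).trans
      (mul_le_mul (hg.1 h' _) ((hh _).1 h' _) (norm_nonneg _) hC)
  · calc ∑ x ∈ s, ‖f x‖ ^ r.toReal
        ≤ ∑ x ∈ s.image Prod.fst ×ˢ s.image Prod.snd, ‖f x‖ ^ r.toReal :=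
          Finset.sum_le_sum_of_subset_of_nonneg
            (fun x hx => Finset.mem_product.2
              ⟨Finset.mem_image_of_mem _ hx, Finset.mem_image_of_mem _ hx⟩)
            fun _ _ _ => by positivity
      _ ≤ ∑ i ∈ s.image Prod.fst, ‖g i‖ ^ r.toReal *
            ∑ j ∈ s.image Prod.snd, ‖h i j‖ ^ r.toReal := by
          rw [Finset.sum_product]
          refine Finset.sum_le_sum fun i _ => ?_
          rw [Finset.mul_sum]
          refine Finset.sum_le_sum fun j _ => ?_
          rw [← Real.mul_rpow (norm_nonneg _) (norm_nonneg _)]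
          exact Real.rpow_le_rpow (norm_nonneg _) (hf i j) ENNReal.toReal_nonneg
      _ ≤ ∑ i ∈ s.image Prod.fst, ‖g i‖ ^ r.toReal * D ^ r.toReal :=
          Finset.sum_le_sum fun i _ => mul_le_mul_of_nonneg_left ((hh i).2 h' _) (by positivity)
      _ ≤ C ^ r.toReal * D ^ r.toReal := by
          rw [← Finset.sum_mul]
          exact mul_le_mul_of_nonneg_right (hg.2 h' _) (by positivity)
      _ = (C * D) ^ r.toReal := (Real.mul_rpow hC hD).symm

theorem lpBound_unit (hr : 1 ≤ r) (x : E) : LpBound r ‖x‖ (fun _ : Unit => x) := by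
  rcases eq_or_ne r ∞ with rfl | h
  · simp [lpBound_top]
  · simp [lpBound_iff_univ h]

/-- **Hölder's inequality** for `LpBound`. -/
theorem LpBound.sum_mul_le {p q : ℝ≥0∞} [hpq : p.HolderConjugate q] {f : ι → E} {g : ι → F}
    (hC : 0 ≤ C) (hD : 0 ≤ D) (hf : LpBound p C f) (hg : LpBound q D g) (s : Finset ι) :
    ∑ i ∈ s, ‖f i‖ * ‖g i‖ ≤ C * D := by
  rcases eq_or_ne p ∞ with rfl | hp
  · obtain rfl := (ENNReal.HolderConjugate.eq_top_iff_eq_one ∞ q).1 rfl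
    calc _ ≤ ∑ i ∈ s, C * ‖g i‖ := Finset.sum_le_sum fun i _ =>
          mul_le_mul_of_nonneg_right (lpBound_top.1 hf i) (norm_nonneg _)
      _ ≤ C * D := by
          rw [← Finset.mul_sum]
          exact mul_le_mul_of_nonneg_left (lpBound_one.1 hg s) hC
  rcases eq_or_ne q ∞ with rfl | hq
  · obtain rfl := (ENNReal.HolderConjugate.eq_top_iff_eq_one ∞ p).1 rfl
    calc _ ≤ ∑ i ∈ s, ‖f i‖ * D := Finset.sum_le_sum fun i _ =>
          mul_le_mul_of_nonneg_left (lpBound_top.1 hg i) (norm_nonneg _)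
      _ ≤ C * D := by
          rw [← Finset.sum_mul]
          exact mul_le_mul_of_nonneg_right (lpBound_one.1 hf s) hD
  have h := ENNReal.HolderConjugate.toReal_of_ne_top (p := p) (q := q) hp hq
  refine (Real.inner_le_Lp_mul_Lq_of_nonneg s h (fun i _ => norm_nonneg _)
    fun i _ => norm_nonneg _).trans (mul_le_mul ?_ ?_ (by positivity) hC)
  · rw [one_div, Real.rpow_inv_le_iff_of_pos (by positivity) hC h.pos]
    exact hf.2 hp s
  · rw [one_div, Real.rpow_inv_le_iff_of_pos (by positivity) hD h.symm.pos]
    exact hg.2 hq s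

theorem exists_norm_le_one_mul_eq_norm {𝕜 : Type*} [RCLike 𝕜] (a : 𝕜) :
    ∃ u : 𝕜, ‖u‖ ≤ 1 ∧ a * u = (‖a‖ : 𝕜) := by
  rcases eq_or_ne a 0 with rfl | ha
  · exact ⟨0, by simp⟩
  · have h : (‖a‖ : 𝕜) ≠ 0 := by simpa using ha
    refine ⟨(starRingEnd 𝕜) a / ‖a‖, ?_, ?_⟩
    · simp [ha]
    · rw [← mul_div_assoc, RCLike.mul_conj, sq, mul_div_cancel_right₀ _ h]

/-- The `ℓ_p` norm of a finite scalar family is attained on the unit ball of `ℓ_q`. -/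
theorem LpBound.of_forall_sum_mul {𝕜 : Type*} [RCLike 𝕜] {p q : ℝ≥0∞}
    [hpq : p.HolderConjugate q] [Fintype ι] (hC : 0 ≤ C) {a : ι → 𝕜}
    (h : ∀ b : ι → 𝕜, LpBound q 1 b → ‖∑ i, a i * b i‖ ≤ C) : LpBound p C a := by
  classical
  choose u hu1 hu using fun i => exists_norm_le_one_mul_eq_norm (a i)
  rcases eq_or_ne p ∞ with rfl | hp
  · obtain rfl := (ENNReal.HolderConjugate.eq_top_iff_eq_one ∞ q).1 rfl
    refine lpBound_top.2 fun i => ?_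
    have := h (Pi.single i (u i)) ?_
    · simpa [Pi.single_apply, hu] using this
    · refine (lpBound_iff_univ (by simp)).2 ?_
      simp only [ENNReal.toReal_one, Real.rpow_one, Pi.single_apply, apply_ite norm, norm_zero]
      simpa using hu1 i
  have key : ∀ g : ι → ℝ, (∀ i, 0 ≤ g i) → LpBound q 1 g → ∑ i, ‖a i‖ * g i ≤ C := by
    intro g hg0 hg
    have := h (fun i => u i * (g i : 𝕜)) (hg.mono zero_le_one le_rfl fun i => ?_)
    · have e : ∑ i, a i * (u i * (g i : 𝕜)) = ((∑ i, ‖a i‖ * g i : ℝ) : 𝕜) := by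
        push_cast
        exact Finset.sum_congr rfl fun i _ => by rw [← mul_assoc, hu]
      rw [e, RCLike.norm_ofReal] at this
      exact (le_abs_self _).trans this
    · rw [norm_mul, RCLike.norm_ofReal, ← Real.norm_eq_abs]
      exact mul_le_of_le_one_left (norm_nonneg _) (hu1 i)
  rcases eq_or_ne q ∞ with rfl | hq
  · obtain rfl := (ENNReal.HolderConjugate.eq_top_iff_eq_one ∞ p).1 rfl
    rw [lpBound_iff_univ hp]
    simpa using key (fun _ => 1) (by simp) (by simp [lpBound_top])
  have hc := ENNReal.HolderConjugate.toReal_of_ne_top (p := p) (q := q) hp hq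
  obtain ⟨⟨g, hg, hg'⟩, -⟩ := NNReal.isGreatest_Lp Finset.univ (fun i => ‖a i‖₊) hc
  have := key (fun i => g i) (by simp) ?_
  · have e : ∑ i, ‖a i‖ * (g i : ℝ) = (∑ i, ‖a i‖ ^ p.toReal) ^ (1 / p.toReal) := by
      simpa using congrArg NNReal.toReal hg'
    rw [e, one_div, Real.rpow_inv_le_iff_of_pos (by positivity) hC hc.pos] at this
    exact (lpBound_iff_univ hp).2 this
  · rw [lpBound_iff_univ hq, Real.one_rpow]
    have : ((∑ i, g i ^ q.toReal : NNReal) : ℝ) ≤ 1 := by exact_mod_cast hg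
    simpa using this

/-! ### Strong and weak norms, and elements of `ℓ_r` -/

theorem strongNorm_nonneg (hr : 1 ≤ r) {E : Type u} [NormedAddCommGroup E] {n : ℕ}
    (x : Fin n → E) : 0 ≤ strongNorm r x := by
  have : Fact (1 ≤ r) := ⟨hr⟩
  exact norm_nonneg _

theorem strongNorm_le_iff (hr : 1 ≤ r) (hC : 0 ≤ C) {E : Type u} [NormedAddCommGroup E] {n : ℕ}
    {x : Fin n → E} : strongNorm r x ≤ C ↔ LpBound r C x := by
  rcases eq_or_ne r ∞ with rfl | h
  · rw [strongNorm, PiLp.norm_eq_ciSup, lpBound_top]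
    refine ⟨fun hx i => (le_ciSup (Set.finite_range _).bddAbove i).trans hx, fun hx => ?_⟩
    exact Real.iSup_le hx hC
  · have h0 := toReal_pos_of_one_le hr h
    rw [strongNorm, PiLp.norm_eq_sum h0, lpBound_iff_univ h, one_div,
      Real.rpow_inv_le_iff_of_pos (by positivity) hC h0]

theorem lpBound_norm_lp (hr : 1 ≤ r) (x : lp (fun _ : ι => E) r) : LpBound r ‖x‖ x := by
  refine ⟨fun h i => ?_, fun h s => ?_⟩
  · exact lp.norm_apply_le_norm (zero_lt_one.trans_le hr).ne' x i
  · exact lp.sum_rpow_le_norm_rpow (toReal_pos_of_one_le hr h) x s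

theorem LpBound.exists_lp (hr : 1 ≤ r) (hC : 0 ≤ C) {f : ι → E} (h : LpBound r C f) :
    ∃ x : lp (fun _ : ι => E) r, (∀ i, x i = f i) ∧ ‖x‖ ≤ C := by
  rcases eq_or_ne r ∞ with rfl | h'
  · exact ⟨⟨f, memℓp_infty ⟨C, by rintro _ ⟨i, rfl⟩; exact lpBound_top.1 h i⟩⟩, fun _ => rfl,
      lp.norm_le_of_forall_le hC (lpBound_top.1 h)⟩
  · exact ⟨⟨f, memℓp_gen' (h.2 h')⟩, fun _ => rfl,
      lp.norm_le_of_forall_sum_le (toReal_pos_of_one_le hr h') hC (h.2 h')⟩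

end LpBound

/-- `WeakBound 𝕜 r C x` says that the family `x` has weak `ℓ_r` norm at most `C`. -/
def WeakBound (𝕜 : Type*) [RCLike 𝕜] {ι E : Type*} [NormedAddCommGroup E] [NormedSpace 𝕜 E]
    (r : ℝ≥0∞) (C : ℝ) (x : ι → E) : Prop :=
  ∀ φ : StrongDual 𝕜 E, ‖φ‖ ≤ 1 → LpBound r C fun i => φ (x i)

section WeakBound

variable {𝕜 : Type} [RCLike 𝕜] {ι κ : Type*} {E : Type u} [NormedAddCommGroup E] [NormedSpace 𝕜 E]
  {r : ℝ≥0∞} {C D : ℝ}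

theorem weakNorm_bddAbove (hr : 1 ≤ r) {n : ℕ} (x : Fin n → E) :
    BddAbove {c : ℝ | ∃ φ : StrongDual 𝕜 E, ‖φ‖ ≤ 1 ∧ c = strongNorm r (fun i => φ (x i))} := by
  refine ⟨strongNorm r x, ?_⟩
  rintro _ ⟨φ, hφ, rfl⟩
  have h0 := strongNorm_nonneg hr x
  rw [strongNorm_le_iff hr h0]
  refine ((strongNorm_le_iff hr h0).1 le_rfl).mono h0 le_rfl fun i => ?_
  simpa using φ.le_of_opNorm_le hφ (x i)

theorem weakNorm_nonneg (hr : 1 ≤ r) {n : ℕ} (x : Fin n → E) : 0 ≤ weakNorm 𝕜 r x :=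
  (strongNorm_nonneg hr _).trans (le_csSup (weakNorm_bddAbove hr x) ⟨0, by simp, rfl⟩)

theorem weakNorm_le_iff (hr : 1 ≤ r) (hC : 0 ≤ C) {n : ℕ} {x : Fin n → E} :
    weakNorm 𝕜 r x ≤ C ↔ WeakBound 𝕜 r C x := by
  refine ⟨fun h φ hφ => ?_, fun h => csSup_le ⟨_, 0, by simp, rfl⟩ ?_⟩
  · rw [← strongNorm_le_iff hr hC]
    exact (le_csSup (weakNorm_bddAbove hr x) ⟨φ, hφ, rfl⟩).trans h
  · rintro _ ⟨φ, hφ, rfl⟩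
    exact (strongNorm_le_iff hr hC).2 (h φ hφ)

theorem WeakBound.mono {x : ι → E} (hC : 0 ≤ C) (hCD : C ≤ D) (h : WeakBound 𝕜 r C x) :
    WeakBound 𝕜 r D x := fun φ hφ => (h φ hφ).mono hC hCD fun _ => le_rfl

theorem WeakBound.const_smul {x : ι → E} (hC : 0 ≤ C) (h : WeakBound 𝕜 r C x) (c : 𝕜) :
    WeakBound 𝕜 r (‖c‖ * C) fun i => c • x i := fun φ hφ =>
  (h φ hφ).mul_left hC (norm_nonneg c) fun i => by simp

theorem WeakBound.comp_injective {x : ι → E} (h : WeakBound 𝕜 r C x) {e : κ → ι}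
    (he : Function.Injective e) : WeakBound 𝕜 r C (x ∘ e) :=
  fun φ hφ => (h φ hφ).comp_injective he

theorem WeakBound.sumElim (hr : 1 ≤ r) {x : ι → E} {y : κ → E} {s t : ℝ} (hs : 0 ≤ s)
    (ht : 0 ≤ t) (hx : WeakBound 𝕜 r (s ^ r.toReal⁻¹) x) (hy : WeakBound 𝕜 r (t ^ r.toReal⁻¹) y) :
    WeakBound 𝕜 r ((s + t) ^ r.toReal⁻¹) (Sum.elim x y) := fun φ hφ => by
  have := LpBound.sumElim hr hs ht (hx φ hφ) (hy φ hφ)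
  convert this using 1
  ext i
  rcases i with i | i <;> rfl

/-- A bounded functional sees a weakly bounded family with a bound scaled by its norm. -/
theorem WeakBound.lpBound {x : ι → E} (hC : 0 ≤ C) (h : WeakBound 𝕜 r C x)
    (φ : StrongDual 𝕜 E) : LpBound r (‖φ‖ * C) fun i => φ (x i) := by
  rcases eq_or_ne φ 0 with rfl | h0
  · have := h 0 (by simp)
    simpa using this.mul_left (g := fun _ : ι => (0 : 𝕜)) hC le_rfl (by simp)
  · have hn : (‖φ‖ : 𝕜) ≠ 0 := by simpa using h0
    refine (h ((‖φ‖ : 𝕜)⁻¹ • φ) ?_).mul_left hC (norm_nonneg _) fun i => ?_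
    · rw [norm_smul]
      simp [h0]
    · simp [h0]

theorem WeakBound.map {F : Type*} [NormedAddCommGroup F] [NormedSpace 𝕜 F] {x : ι → E}
    (hC : 0 ≤ C) (h : WeakBound 𝕜 r C x) (S : E →L[𝕜] F) :
    WeakBound 𝕜 r (‖S‖ * C) fun i => S (x i) := fun φ hφ => by
  have h1 := h.lpBound hC (φ.comp S)
  refine h1.mono (by positivity) (mul_le_mul_of_nonneg_right ?_ hC) fun i => le_rfl
  exact (φ.opNorm_comp_le S).trans (mul_le_of_le_one_left (norm_nonneg _) hφ)

/-- The weak `ℓ_p` norm of a finite family is the norm of the operator it induces on `ℓ_q`. -/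
theorem WeakBound.of_forall_sum_smul {p q : ℝ≥0∞} [p.HolderConjugate q] [Fintype ι] {x : ι → E}
    (hC : 0 ≤ C) (h : ∀ b : ι → 𝕜, LpBound q 1 b → ‖∑ i, b i • x i‖ ≤ C) :
    WeakBound 𝕜 p C x := fun φ hφ =>
  LpBound.of_forall_sum_mul (q := q) hC fun b hb => by
    have e : ∑ i, φ (x i) * b i = φ (∑ i, b i • x i) := by simp [mul_comm]
    rw [e]
    exact ((φ.le_of_opNorm_le hφ _).trans (by rw [one_mul])).trans (h b hb)

end WeakBound

/-! ### Slices of tensors and separation by functionals -/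

section Slices

variable {𝕜 : Type} [RCLike 𝕜] {E F : Type u} [NormedAddCommGroup E] [NormedSpace 𝕜 E]
  [NormedAddCommGroup F] [NormedSpace 𝕜 F]

/-- Applying a functional to the left factor of a tensor: `x ⊗ y ↦ φ x • y`. -/
noncomputable def leftSlice (F : Type u) [NormedAddCommGroup F] [NormedSpace 𝕜 F]
    (φ : StrongDual 𝕜 E) : E ⊗[𝕜] F →ₗ[𝕜] F :=
  (TensorProduct.lid 𝕜 F).toLinearMap ∘ₗ
    TensorProduct.map φ.toLinearMap (LinearMap.id : F →ₗ[𝕜] F)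

@[simp]
theorem leftSlice_tmul (φ : StrongDual 𝕜 E) (x : E) (y : F) :
    leftSlice F φ (x ⊗ₜ[𝕜] y) = φ x • y := by
  simp [leftSlice]

theorem leftSlice_sum_tmul {ι : Type*} [Fintype ι] (φ : StrongDual 𝕜 E) (x : ι → E) (y : ι → F) :
    leftSlice F φ (∑ i, x i ⊗ₜ[𝕜] y i) = ∑ i, φ (x i) • y i := by
  simp

theorem leftSlice_smul (c : 𝕜) (φ : StrongDual 𝕜 E) (z : E ⊗[𝕜] F) :
    leftSlice F (c • φ) z = c • leftSlice F φ z := by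
  induction z with
  | zero => simp
  | tmul x y => simp [mul_smul]
  | add z w hz hw => simp only [map_add, smul_add, hz, hw]

theorem tensorPairing_tmul (z : E ⊗[𝕜] F) (φ : StrongDual 𝕜 E) (ψ : StrongDual 𝕜 F) :
    tensorPairing 𝕜 E F z (φ ⊗ₜ[𝕜] ψ) = ψ (leftSlice F φ z) := by
  induction z with
  | zero => simp [tensorPairing]
  | tmul x y => simp [tensorPairing]
  | add z w hz hw =>
    rw [map_add, map_add, ← hz, ← hw]
    simp [tensorPairing]

theorem tensorPairing_sum_tmul {ι : Type*} [Fintype ι] (z : E ⊗[𝕜] F) (φ : ι → StrongDual 𝕜 E)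
    (ψ : ι → StrongDual 𝕜 F) :
    tensorPairing 𝕜 E F z (∑ i, φ i ⊗ₜ[𝕜] ψ i) = ∑ i, ψ i (leftSlice F (φ i) z) := by
  simp_rw [← tensorPairing_tmul]
  simp [tensorPairing]

theorem leftSlice_map {G H : Type u} [NormedAddCommGroup G] [NormedSpace 𝕜 G]
    [NormedAddCommGroup H] [NormedSpace 𝕜 H] (φ : StrongDual 𝕜 G) (S : E →L[𝕜] G) (T : F →ₗ[𝕜] H)
    (z : E ⊗[𝕜] F) :
    leftSlice H φ (TensorProduct.map S.toLinearMap T z) = T (leftSlice F (φ.comp S) z) := by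
  induction z with
  | zero => simp
  | tmul x y => simp
  | add z w hz hw => simp only [map_add, hz, hw]

/-- Functionals on the left factor separate the points of a tensor product. -/
theorem eq_zero_of_leftSlice (z : E ⊗[𝕜] F) (h : ∀ φ : StrongDual 𝕜 E, leftSlice F φ z = 0) :
    z = 0 := by
  obtain ⟨M, hM, hz⟩ := TensorProduct.exists_finite_submodule_left_of_setFinite {z}
    (Set.finite_singleton z)
  obtain ⟨w, rfl⟩ := hz rfl
  suffices hw : w = 0 by rw [hw, map_zero]
  have hfin : FiniteDimensional 𝕜 M := hM
  let b := Module.finBasis 𝕜 M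
  refine (TensorProduct.equivFinsuppOfBasisLeft (N := F) b).injective ?_
  ext i
  rw [TensorProduct.equivFinsuppOfBasisLeft_apply]
  obtain ⟨φ, hφ, -⟩ := exists_extension_norm_eq M (LinearMap.toContinuousLinearMap (b.coord i))
  have := h φ
  have e : leftSlice F φ (LinearMap.rTensor F M.subtype w) =
      TensorProduct.lid 𝕜 F (LinearMap.rTensor F (b.coord i) w) := by
    clear this h hz
    induction w with
    | zero => simp
    | tmul x y => simp [hφ]
    | add z w hz hw => simp only [map_add, hz, hw]
  rw [← e, this]
  simp

theorem eq_zero_of_tensorPairing (z : E ⊗[𝕜] F)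
    (h : ∀ (φ : StrongDual 𝕜 E) (ψ : StrongDual 𝕜 F), ‖φ‖ ≤ 1 → ‖ψ‖ ≤ 1 →
      tensorPairing 𝕜 E F z (φ ⊗ₜ[𝕜] ψ) = 0) : z = 0 := by
  refine eq_zero_of_leftSlice z fun φ => ?_
  have h1 : ∀ φ : StrongDual 𝕜 E, ‖φ‖ ≤ 1 → leftSlice F φ z = 0 := by
    intro φ hφ
    obtain ⟨ψ, hψ, hψ'⟩ := exists_dual_vector'' 𝕜 (leftSlice F φ z)
    rw [← tensorPairing_tmul, h φ ψ hφ hψ] at hψ'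
    simpa using hψ'.symm
  rcases eq_or_ne φ 0 with rfl | h0
  · exact h1 0 (by simp)
  · have hn : (‖φ‖ : 𝕜) ≠ 0 := by simpa using h0
    have := h1 ((‖φ‖ : 𝕜)⁻¹ • φ) (by rw [norm_smul]; simp [h0])
    rw [leftSlice_smul] at this
    simpa [h0] using this

end Slices

/-! ### The Chevet-Saphar norms -/

theorem exists_rescaling {A B t a b : ℝ} (hA : 0 ≤ A) (hB : 0 ≤ B) (hab : a + b = 1)
    (h : A * B < t) : ∃ c : ℝ, 0 < c ∧ c * A ≤ t ^ a ∧ c⁻¹ * B ≤ t ^ b := by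
  have ht : 0 < t := (mul_nonneg hA hB).trans_lt h
  have hta : 0 < t ^ a := Real.rpow_pos_of_pos ht a
  have htb : 0 < t ^ b := Real.rpow_pos_of_pos ht b
  rcases hA.eq_or_lt with rfl | hA
  · refine ⟨(B + 1) / t ^ b, by positivity, by simpa using hta.le, ?_⟩
    rw [inv_div, div_mul_eq_mul_div, div_le_iff₀ (by positivity)]
    nlinarith
  · refine ⟨t ^ a / A, by positivity, by field_simp; exact le_rfl, ?_⟩
    rw [inv_div, div_mul_eq_mul_div, div_le_iff₀ hta, ← Real.rpow_add ht, add_comm b, hab,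
      Real.rpow_one]
    exact h.le

theorem le_mul_of_forall_gt {a b c : ℝ} (h : ∀ t, a < t → b ≤ c * t) :
    b ≤ c * a := by
  have : Filter.Tendsto (fun t => c * t) (𝓝[>] a) (𝓝 (c * a)) :=
    ((continuous_const.mul continuous_id).tendsto a).mono_left nhdsWithin_le_nhds
  exact ge_of_tendsto this (Filter.eventually_of_mem self_mem_nhdsWithin h)

theorem toReal_inv_add_toReal_inv (p q : ℝ≥0∞) [p.HolderConjugate q] :
    p.toReal⁻¹ + q.toReal⁻¹ = 1 := by
  have hp := ENNReal.HolderConjugate.pos p q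
  have hq := ENNReal.HolderConjugate.pos q p
  have := congrArg ENNReal.toReal (ENNReal.HolderConjugate.inv_add_inv_eq_one p q)
  rwa [ENNReal.toReal_add (by simpa using hp.ne') (by simpa using hq.ne'), ENNReal.toReal_inv,
    ENNReal.toReal_inv, ENNReal.toReal_one] at this

section ChevetSaphar

variable {𝕜 : Type} [RCLike 𝕜] {p q : ℝ≥0∞} [hpq : p.HolderConjugate q]
  {E F G H : Type u} [NormedAddCommGroup E] [NormedSpace 𝕜 E]
  [NormedAddCommGroup F] [NormedSpace 𝕜 F] [NormedAddCommGroup G] [NormedSpace 𝕜 G]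
  [NormedAddCommGroup H] [NormedSpace 𝕜 H]

include hpq in
theorem chevetSapharD_bddBelow (z : E ⊗[𝕜] F) :
    BddBelow {c : ℝ | ∃ (n : ℕ) (x : Fin n → E) (y : Fin n → F), z = ∑ i, x i ⊗ₜ[𝕜] y i ∧
      c = weakNorm 𝕜 (ENNReal.conjExponent p) x * strongNorm p y} := by
  refine ⟨0, ?_⟩
  rintro _ ⟨n, x, y, -, rfl⟩
  rw [ENNReal.HolderConjugate.conjExponent_eq (p := p) (q := q)]
  exact mul_nonneg (weakNorm_nonneg (ENNReal.HolderConjugate.one_le q p) x)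
    (strongNorm_nonneg (ENNReal.HolderConjugate.one_le p q) y)

theorem chevetSapharD_nonneg (hp : 1 ≤ p) (z : E ⊗[𝕜] F) : 0 ≤ chevetSapharD 𝕜 p E F z := by
  have hpq := ENNReal.HolderConjugate.conjExponent hp
  refine Real.sInf_nonneg ?_
  rintro _ ⟨n, x, y, -, rfl⟩
  exact mul_nonneg (weakNorm_nonneg (ENNReal.HolderConjugate.one_le _ p) x)
    (strongNorm_nonneg hp y)

theorem chevetSapharD_le {ι : Type*} [Fintype ι] {z : E ⊗[𝕜] F} {x : ι → E} {y : ι → F} {A B : ℝ}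
    (hA : 0 ≤ A) (hB : 0 ≤ B) (hz : z = ∑ i, x i ⊗ₜ[𝕜] y i) (hx : WeakBound 𝕜 q A x)
    (hy : LpBound p B y) : chevetSapharD 𝕜 p E F z ≤ A * B := by
  let e := (Fintype.equivFin ι).symm
  have hp1 := ENNReal.HolderConjugate.one_le p q
  have hq1 := ENNReal.HolderConjugate.one_le q p
  refine (csInf_le (chevetSapharD_bddBelow (q := q) z) ⟨_, x ∘ e, y ∘ e, ?_, rfl⟩).trans ?_
  · rw [hz]
    exact (e.sum_comp fun i => x i ⊗ₜ[𝕜] y i).symm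
  · rw [ENNReal.HolderConjugate.conjExponent_eq (p := p) (q := q)]
    exact mul_le_mul ((weakNorm_le_iff hq1 hA).2 (hx.comp_injective e.injective))
      ((strongNorm_le_iff hp1 hB).2 (hy.comp_injective e.injective)) (strongNorm_nonneg hp1 _) hA

/-- If `d_p z < t`, then `z` has a representation whose weak and strong norms are at most
`t ^ (1 / q)` and `t ^ (1 / p)`. With this normalization concatenated representations have
additive bounds. -/
theorem exists_rep_of_chevetSapharD_lt {z : E ⊗[𝕜] F} {t : ℝ}
    (ht : chevetSapharD 𝕜 p E F z < t) :
    ∃ (n : ℕ) (x : Fin n → E) (y : Fin n → F), z = ∑ i, x i ⊗ₜ[𝕜] y i ∧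
      WeakBound 𝕜 q (t ^ q.toReal⁻¹) x ∧ LpBound p (t ^ p.toReal⁻¹) y := by
  have hp1 := ENNReal.HolderConjugate.one_le p q
  have hq1 := ENNReal.HolderConjugate.one_le q p
  obtain ⟨n₀, x₀, y₀, h₀⟩ := TensorProduct.exists_sum_tmul_eq z
  have hne : Set.Nonempty {c : ℝ | ∃ (n : ℕ) (x : Fin n → E) (y : Fin n → F),
      z = ∑ i, x i ⊗ₜ[𝕜] y i ∧ c = weakNorm 𝕜 (ENNReal.conjExponent p) x * strongNorm p y} :=
    ⟨_, n₀, x₀, y₀, h₀, rfl⟩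
  obtain ⟨_, ⟨n, x, y, hz, rfl⟩, hlt⟩ := exists_lt_of_csInf_lt hne ht
  rw [ENNReal.HolderConjugate.conjExponent_eq (p := p) (q := q)] at hlt
  have hA := weakNorm_nonneg (𝕜 := 𝕜) hq1 x
  have hB := strongNorm_nonneg hp1 y
  obtain ⟨c, hc, h1, h2⟩ := exists_rescaling hA hB
    (by rw [add_comm]; exact toReal_inv_add_toReal_inv p q) hlt
  have hx := (weakNorm_le_iff hq1 hA).1 le_rfl
  have hy := (strongNorm_le_iff hp1 hB).1 le_rfl
  have hc' : (c : 𝕜) ≠ 0 := by simpa using hc.ne'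
  refine ⟨n, fun i => (c : 𝕜) • x i, fun i => (c : 𝕜)⁻¹ • y i, ?_, ?_, ?_⟩
  · rw [hz]
    refine Finset.sum_congr rfl fun i _ => ?_
    rw [TensorProduct.smul_tmul, smul_smul, mul_inv_cancel₀ hc', one_smul]
  · refine (hx.const_smul hA (c : 𝕜)).mono (by positivity) ?_
    rwa [RCLike.norm_ofReal, abs_of_pos hc]
  · have := hy.mul_left hB (D := c⁻¹) (g := fun i => (c : 𝕜)⁻¹ • y i) (by positivity)
      fun i => by rw [norm_smul, norm_inv, RCLike.norm_ofReal, abs_of_pos hc]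
    exact this.mono (by positivity) h2 fun _ => le_rfl

theorem rpow_toReal_inv_mul_rpow (p q : ℝ≥0∞) [p.HolderConjugate q] {t : ℝ} (ht : 0 < t) :
    t ^ q.toReal⁻¹ * t ^ p.toReal⁻¹ = t := by
  rw [← Real.rpow_add ht, add_comm, toReal_inv_add_toReal_inv, Real.rpow_one]

theorem chevetSapharD_add_le (hp : 1 ≤ p) (z w : E ⊗[𝕜] F) :
    chevetSapharD 𝕜 p E F (z + w) ≤ chevetSapharD 𝕜 p E F z + chevetSapharD 𝕜 p E F w := by
  have hpq := ENNReal.HolderConjugate.conjExponent hp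
  have hq := ENNReal.HolderConjugate.one_le (ENNReal.conjExponent p) p
  refine le_of_forall_pos_le_add fun ε hε => ?_
  set s := chevetSapharD 𝕜 p E F z + ε / 2 with hs
  set t := chevetSapharD 𝕜 p E F w + ε / 2 with ht
  have hs0 : 0 < s := by have := chevetSapharD_nonneg hp z; positivity
  have ht0 : 0 < t := by have := chevetSapharD_nonneg hp w; positivity
  obtain ⟨n, x, y, hz, hx, hy⟩ := exists_rep_of_chevetSapharD_lt (p := p)
    (show chevetSapharD 𝕜 p E F z < s by linarith) (q := ENNReal.conjExponent p)
  obtain ⟨m, x', y', hw, hx', hy'⟩ := exists_rep_of_chevetSapharD_lt (p := p)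
    (show chevetSapharD 𝕜 p E F w < t by linarith) (q := ENNReal.conjExponent p)
  refine (chevetSapharD_le (by positivity) (by positivity) ?_ (hx.sumElim hq hs0.le ht0.le hx')
    (hy.sumElim hp hs0.le ht0.le hy')).trans ?_
  · rw [Fintype.sum_sum_type]
    simp [hz, hw]
  · rw [rpow_toReal_inv_mul_rpow _ _ (add_pos hs0 ht0)]
    linarith

theorem chevetSapharD_map_le (hp : 1 ≤ p) (S : E →L[𝕜] G) (T : F →L[𝕜] H) (z : E ⊗[𝕜] F) :
    chevetSapharD 𝕜 p G H (TensorProduct.map S.toLinearMap T.toLinearMap z) ≤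
      ‖S‖ * ‖T‖ * chevetSapharD 𝕜 p E F z := by
  have hpq := ENNReal.HolderConjugate.conjExponent hp
  have h0 := chevetSapharD_nonneg hp z
  have key : ∀ t, chevetSapharD 𝕜 p E F z < t →
      chevetSapharD 𝕜 p G H (TensorProduct.map S.toLinearMap T.toLinearMap z) ≤
        ‖S‖ * ‖T‖ * t := by
    intro t ht
    have ht0 := h0.trans_lt ht
    obtain ⟨n, x, y, hz, hx, hy⟩ := exists_rep_of_chevetSapharD_lt (p := p) ht
      (q := ENNReal.conjExponent p)
    refine (chevetSapharD_le (x := fun i => S (x i)) (y := fun i => T (y i))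
      (by positivity) (by positivity) (by simp [hz])
      (hx.map (by positivity) S)
      (hy.mul_left (by positivity) (norm_nonneg T) fun i => T.le_opNorm _)).trans (le_of_eq ?_)
    calc _ = ‖S‖ * ‖T‖ * (t ^ (ENNReal.conjExponent p).toReal⁻¹ * t ^ p.toReal⁻¹) := by ring
      _ = _ := by rw [rpow_toReal_inv_mul_rpow p _ ht0]
  exact le_mul_of_forall_gt key

theorem chevetSapharD_smul_le (hp : 1 ≤ p) (c : 𝕜) (z : E ⊗[𝕜] F) :
    chevetSapharD 𝕜 p E F (c • z) ≤ ‖c‖ * chevetSapharD 𝕜 p E F z := by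
  have h := chevetSapharD_map_le hp (c • ContinuousLinearMap.id 𝕜 E) (ContinuousLinearMap.id 𝕜 F) z
  have e : TensorProduct.map (c • ContinuousLinearMap.id 𝕜 E).toLinearMap
      (ContinuousLinearMap.id 𝕜 F).toLinearMap z = c • z := by
    induction z with
    | zero => simp
    | tmul x y => simp [TensorProduct.smul_tmul']
    | add z w hz hw => simp only [map_add, smul_add, hz (chevetSapharD_map_le hp _ _ _),
        hw (chevetSapharD_map_le hp _ _ _)]
  rw [e] at h
  refine h.trans (mul_le_mul_of_nonneg_right ?_ (chevetSapharD_nonneg hp z))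
  rw [norm_smul, mul_assoc]
  exact mul_le_of_le_one_right (norm_nonneg c) (mul_le_one₀ ContinuousLinearMap.norm_id_le
    (norm_nonneg _) ContinuousLinearMap.norm_id_le)

theorem norm_tensorPairing_le_chevetSapharD (hp : 1 ≤ p) (z : E ⊗[𝕜] F) (φ : StrongDual 𝕜 E)
    (ψ : StrongDual 𝕜 F) (hφ : ‖φ‖ ≤ 1) (hψ : ‖ψ‖ ≤ 1) :
    ‖tensorPairing 𝕜 E F z (φ ⊗ₜ[𝕜] ψ)‖ ≤ chevetSapharD 𝕜 p E F z := by
  have hpq := ENNReal.HolderConjugate.conjExponent hp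
  refine le_of_forall_gt fun t ht => ?_
  obtain ⟨t', ht', htt'⟩ := exists_between ht
  have ht0 := (chevetSapharD_nonneg hp z).trans_lt ht'
  refine lt_of_le_of_lt ?_ htt'
  obtain ⟨n, x, y, hz, hx, hy⟩ := exists_rep_of_chevetSapharD_lt (p := p) ht'
    (q := ENNReal.conjExponent p)
  rw [tensorPairing_tmul, hz, leftSlice_sum_tmul, map_sum]
  calc ‖∑ i, ψ (φ (x i) • y i)‖ ≤ ∑ i, ‖φ (x i)‖ * ‖y i‖ := by
        refine (norm_sum_le _ _).trans (Finset.sum_le_sum fun i _ => ?_)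
        rw [map_smul, norm_smul]
        gcongr
        simpa using ψ.le_of_opNorm_le hψ (y i)
    _ ≤ t' := by
        have := (hx φ hφ).sum_mul_le (p := ENNReal.conjExponent p) (q := p)
          (by positivity) (by positivity) hy Finset.univ
        rwa [rpow_toReal_inv_mul_rpow p _ ht0] at this

theorem WeakBound.unit {r : ℝ≥0∞} (hr : 1 ≤ r) (x : E) :
    WeakBound 𝕜 r ‖x‖ (fun _ : Unit => x) := fun φ hφ =>
  (lpBound_unit hr (φ x)).mono (norm_nonneg _) (by simpa using φ.le_of_opNorm_le hφ x)
    fun _ => le_rfl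

theorem isTensorNorm_chevetSapharD (hp : 1 ≤ p) : IsTensorNorm.{u} (chevetSapharD 𝕜 p) where
  add_le E F _ _ _ _ z w := chevetSapharD_add_le hp z w
  smul_eq E F _ _ _ _ c z := by
    refine le_antisymm (chevetSapharD_smul_le hp c z) ?_
    rcases eq_or_ne c 0 with rfl | hc
    · simpa using chevetSapharD_nonneg hp _
    · have := chevetSapharD_smul_le hp c⁻¹ (c • z)
      rw [inv_smul_smul₀ hc, norm_inv] at this
      rwa [← le_inv_mul_iff₀ (by simpa using hc)]
  eq_zero E F _ _ _ _ z hz := eq_zero_of_tensorPairing z fun φ ψ hφ hψ => by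
    have := norm_tensorPairing_le_chevetSapharD hp z φ ψ hφ hψ
    rw [hz] at this
    exact norm_le_zero_iff.1 this
  tmul_le E F _ _ _ _ x y := by
    have hpq := ENNReal.HolderConjugate.conjExponent hp
    exact chevetSapharD_le (ι := Unit) (norm_nonneg _) (norm_nonneg _) (by simp)
      (WeakBound.unit (ENNReal.HolderConjugate.one_le (ENNReal.conjExponent p) p) x)
      (lpBound_unit hp y)
  injective_le E F _ _ _ _ z φ ψ hφ hψ := norm_tensorPairing_le_chevetSapharD hp z φ ψ hφ hψ
  map_le E F G H _ _ _ _ _ _ _ _ S T z := chevetSapharD_map_le hp S T z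

end ChevetSaphar

/-! ### Spaces of bounded functions -/

section Linfty

variable {𝕜 : Type} [RCLike 𝕜] {S T : Type u}

/-- Evaluation of bounded functions at a point. -/
noncomputable def linftyEval (s : S) : StrongDual 𝕜 (lp (fun _ : S => 𝕜) ∞) :=
  LinearMap.mkContinuous
    { toFun := fun f => f s
      map_add' := fun _ _ => rfl
      map_smul' := fun _ _ => rfl } 1
    fun f => by
      rw [one_mul]
      exact lp.norm_apply_le_norm ENNReal.top_ne_zero f s

@[simp]
theorem linftyEval_apply (s : S) (f : lp (fun _ : S => 𝕜) ∞) :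
    (linftyEval s : StrongDual 𝕜 (lp (fun _ : S => 𝕜) ∞)) f = f s := rfl

theorem norm_linftyEval_le (s : S) : ‖(linftyEval s : StrongDual 𝕜 (lp (fun _ : S => 𝕜) ∞))‖ ≤ 1 :=
  LinearMap.mkContinuous_norm_le _ zero_le_one _

/-- Composition with a map of the index sets, as a contraction between spaces of bounded
functions. -/
noncomputable def linftyComp (𝕜 : Type) [RCLike 𝕜] {S T : Type u} (ρ : T → S) :
    lp (fun _ : S => 𝕜) ∞ →L[𝕜] lp (fun _ : T => 𝕜) ∞ :=
  LinearMap.mkContinuous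
    { toFun := fun f => ⟨fun t => f (ρ t), memℓp_infty ⟨‖f‖, by
        rintro _ ⟨t, rfl⟩
        exact lp.norm_apply_le_norm ENNReal.top_ne_zero f (ρ t)⟩⟩
      map_add' := fun _ _ => rfl
      map_smul' := fun _ _ => rfl } 1
    fun f => by
      rw [one_mul]
      exact lp.norm_le_of_forall_le (norm_nonneg f) fun t =>
        lp.norm_apply_le_norm ENNReal.top_ne_zero f (ρ t)

theorem norm_linftyComp_le (ρ : T → S) : ‖linftyComp 𝕜 ρ‖ ≤ 1 :=
  LinearMap.mkContinuous_norm_le _ zero_le_one _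

/-- The weak `ℓ_q` norm of finitely many bounded functions is computed pointwise. -/
theorem WeakBound.of_forall_apply {p q : ℝ≥0∞} [hpq : p.HolderConjugate q] {κ : Type*} [Fintype κ]
    {A : ℝ} (hA : 0 ≤ A) {x : κ → lp (fun _ : S => 𝕜) ∞}
    (h : ∀ s, LpBound q A fun i => x i s) : WeakBound 𝕜 q A x := by
  refine WeakBound.of_forall_sum_smul (q := p) hA fun b hb =>
    lp.norm_le_of_forall_le hA fun s => ?_
  have e : (∑ i, b i • x i) s = ∑ i, b i * x i s := by
    rw [← linftyEval_apply, map_sum]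
    rfl
  rw [e]
  calc ‖∑ i, b i * x i s‖ ≤ ∑ i, ‖b i‖ * ‖x i s‖ := by
        refine (norm_sum_le _ _).trans (Finset.sum_le_sum fun i _ => ?_)
        rw [norm_mul]
    _ ≤ 1 * A := hb.sum_mul_le zero_le_one hA (h s) _
    _ = A := one_mul A

variable {E : Type u} [NormedAddCommGroup E] [NormedSpace 𝕜 E]

/-- The canonical embedding of `E` into `ℓ_∞(B_{E'})` as a bounded operator. -/
noncomputable def evalEmbeddingL (𝕜 : Type) [RCLike 𝕜] (E : Type u) [NormedAddCommGroup E]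
    [NormedSpace 𝕜 E] : E →L[𝕜] LinftyDualBall 𝕜 E :=
  LinearMap.mkContinuous (evalEmbedding 𝕜 E) 1 fun x => by
    rw [one_mul]
    refine lp.norm_le_of_forall_le (norm_nonneg x) fun φ => ?_
    have h : ‖(φ : StrongDual 𝕜 E)‖ ≤ 1 := mem_closedBall_zero_iff.mp φ.2
    exact ((φ : StrongDual 𝕜 E).le_of_opNorm_le h x).trans (one_mul _).le

@[simp]
theorem evalEmbedding_apply (x : E) (φ : Metric.closedBall (0 : StrongDual 𝕜 E) 1) :
    evalEmbedding 𝕜 E x φ = (φ : StrongDual 𝕜 E) x := rfl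

theorem toLinearMap_evalEmbeddingL :
    (evalEmbeddingL 𝕜 E).toLinearMap = evalEmbedding 𝕜 E := rfl

theorem norm_evalEmbeddingL_le : ‖evalEmbeddingL 𝕜 E‖ ≤ 1 :=
  LinearMap.mkContinuous_norm_le _ zero_le_one _

theorem linftyEval_comp_evalEmbeddingL (φ : Metric.closedBall (0 : StrongDual 𝕜 E) 1) :
    (linftyEval φ).comp (evalEmbeddingL 𝕜 E) = (φ : StrongDual 𝕜 E) := rfl

theorem leftSlice_linftyEval_map_evalEmbedding {F : Type u} [NormedAddCommGroup F]
    [NormedSpace 𝕜 F] (φ : Metric.closedBall (0 : StrongDual 𝕜 E) 1) (z : E ⊗[𝕜] F) :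
    leftSlice F (linftyEval φ) (TensorProduct.map (evalEmbedding 𝕜 E) LinearMap.id z) =
      leftSlice F (φ : StrongDual 𝕜 E) z := by
  rw [← toLinearMap_evalEmbeddingL, leftSlice_map, linftyEval_comp_evalEmbeddingL]
  rfl

end Linfty

/-! ### The left injective associate of a tensor norm -/

section LeftInjectiveAssociate

variable {𝕜 : Type} [RCLike 𝕜] {α : TensorFamily.{u} 𝕜}
  {E F G H : Type u} [NormedAddCommGroup E] [NormedSpace 𝕜 E]
  [NormedAddCommGroup F] [NormedSpace 𝕜 F] [NormedAddCommGroup G] [NormedSpace 𝕜 G]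
  [NormedAddCommGroup H] [NormedSpace 𝕜 H]

theorem IsTensorNorm.nonneg (hα : IsTensorNorm α) (z : E ⊗[𝕜] F) : 0 ≤ α E F z :=
  (norm_nonneg _).trans (hα.injective_le E F z 0 0 (by simp) (by simp))

theorem IsTensorNorm.map_le_of_norm_le_one (hα : IsTensorNorm α) (S : E →L[𝕜] G) (T : F →L[𝕜] H)
    (hS : ‖S‖ ≤ 1) (hT : ‖T‖ ≤ 1) (z : E ⊗[𝕜] F) :
    α G H (TensorProduct.map S.toLinearMap T.toLinearMap z) ≤ α E F z :=
  (hα.map_le E F G H S T z).trans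
    (mul_le_of_le_one_left (hα.nonneg z) (mul_le_one₀ hS (norm_nonneg _) hT))

theorem IsTensorNorm.map_id_le (hα : IsTensorNorm α) (S : E →L[𝕜] G) (hS : ‖S‖ ≤ 1)
    (z : E ⊗[𝕜] F) : α G F (TensorProduct.map S.toLinearMap LinearMap.id z) ≤ α E F z :=
  hα.map_le_of_norm_le_one S (ContinuousLinearMap.id 𝕜 F) hS ContinuousLinearMap.norm_id_le z

theorem exists_comp_eq_of_linearIsometry (I : E →ₗᵢ[𝕜] G) (φ : StrongDual 𝕜 E) :
    ∃ ψ : StrongDual 𝕜 G, ‖ψ‖ ≤ ‖φ‖ ∧ ∀ x, ψ (I x) = φ x := by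
  let e := I.equivRange
  obtain ⟨ψ, h1, h2⟩ := exists_extension_norm_eq (LinearMap.range I.toLinearMap)
    (φ.comp (e.symm.toContinuousLinearEquiv : _ →L[𝕜] E))
  refine ⟨ψ, ?_, fun x => ?_⟩
  · rw [h2]
    refine (φ.opNorm_comp_le _).trans (mul_le_of_le_one_right (norm_nonneg _) ?_)
    exact ContinuousLinearMap.opNorm_le_bound _ zero_le_one fun x => by simp
  · have h : ψ (I x) = φ (e.symm (e x)) := h1 (e x)
    rw [h, e.symm_apply_apply]

theorem leftInjectiveAssociate_map_le (hα : IsTensorNorm α) (S : E →L[𝕜] G) (T : F →L[𝕜] H)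
    (z : E ⊗[𝕜] F) :
    leftInjectiveAssociate α G H (TensorProduct.map S.toLinearMap T.toLinearMap z) ≤
      ‖S‖ * ‖T‖ * leftInjectiveAssociate α E F z := by
  let ρ : Metric.closedBall (0 : StrongDual 𝕜 G) 1 → Metric.closedBall (0 : StrongDual 𝕜 E) 1 :=
    fun ψ => ⟨(‖S‖ : 𝕜)⁻¹ • (ψ : StrongDual 𝕜 G).comp S, by
      have h : ‖(ψ : StrongDual 𝕜 G)‖ ≤ 1 := mem_closedBall_zero_iff.mp ψ.2
      rw [mem_closedBall_zero_iff, norm_smul, norm_inv, RCLike.norm_ofReal, abs_norm]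
      refine inv_mul_le_one_of_le₀ ?_ (norm_nonneg S)
      exact ((ψ : StrongDual 𝕜 G).opNorm_comp_le S).trans
        (mul_le_of_le_one_left (norm_nonneg _) h)⟩
  let R : LinftyDualBall 𝕜 E →L[𝕜] LinftyDualBall 𝕜 G := (‖S‖ : 𝕜) • linftyComp 𝕜 ρ
  have hR : ‖R‖ ≤ ‖S‖ := by
    rw [norm_smul, RCLike.norm_ofReal, abs_norm]
    exact mul_le_of_le_one_right (norm_nonneg _) (norm_linftyComp_le ρ)
  have e1 : evalEmbedding 𝕜 G ∘ₗ S.toLinearMap = R.toLinearMap ∘ₗ evalEmbedding 𝕜 E := by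
    ext x ψ
    change (ψ : StrongDual 𝕜 G) (S x) = (‖S‖ : 𝕜) * ((‖S‖ : 𝕜)⁻¹ * (ψ : StrongDual 𝕜 G) (S x))
    rcases eq_or_ne S 0 with rfl | h0
    · simp
    · rw [mul_inv_cancel_left₀ (by simpa using h0)]
  have e : TensorProduct.map (evalEmbedding 𝕜 G) LinearMap.id
      (TensorProduct.map S.toLinearMap T.toLinearMap z) =
      TensorProduct.map R.toLinearMap T.toLinearMap
        (TensorProduct.map (evalEmbedding 𝕜 E) LinearMap.id z) := by
    rw [← LinearMap.comp_apply, ← LinearMap.comp_apply, ← TensorProduct.map_comp,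
      ← TensorProduct.map_comp, e1, LinearMap.id_comp, LinearMap.comp_id]
  rw [leftInjectiveAssociate, e]
  refine (hα.map_le _ _ _ _ R T _).trans ?_
  have := hα.nonneg (TensorProduct.map (evalEmbedding 𝕜 E) LinearMap.id z)
  exact mul_le_mul_of_nonneg_right (mul_le_mul_of_nonneg_right hR (norm_nonneg _)) this

theorem leftInjectiveAssociate_le (hα : IsTensorNorm α) (z : E ⊗[𝕜] F) :
    leftInjectiveAssociate α E F z ≤ α E F z :=
  hα.map_id_le (evalEmbeddingL 𝕜 E) norm_evalEmbeddingL_le z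

theorem norm_tensorPairing_le_leftInjectiveAssociate (hα : IsTensorNorm α) (z : E ⊗[𝕜] F)
    (φ : StrongDual 𝕜 E) (ψ : StrongDual 𝕜 F) (hφ : ‖φ‖ ≤ 1) (hψ : ‖ψ‖ ≤ 1) :
    ‖tensorPairing 𝕜 E F z (φ ⊗ₜ[𝕜] ψ)‖ ≤ leftInjectiveAssociate α E F z := by
  let φ' : Metric.closedBall (0 : StrongDual 𝕜 E) 1 := ⟨φ, mem_closedBall_zero_iff.2 hφ⟩
  have := hα.injective_le _ _ (TensorProduct.map (evalEmbedding 𝕜 E) LinearMap.id z)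
    (linftyEval φ') ψ (norm_linftyEval_le φ') hψ
  rwa [tensorPairing_tmul, leftSlice_linftyEval_map_evalEmbedding, ← tensorPairing_tmul] at this

theorem isTensorNorm_leftInjectiveAssociate (hα : IsTensorNorm α) :
    IsTensorNorm (leftInjectiveAssociate α) where
  add_le E F _ _ _ _ z w := by
    rw [leftInjectiveAssociate, map_add]
    exact hα.add_le _ _ _ _
  smul_eq E F _ _ _ _ c z := by
    rw [leftInjectiveAssociate, map_smul]
    exact hα.smul_eq _ _ _ _
  eq_zero E F _ _ _ _ z hz := eq_zero_of_tensorPairing z fun φ ψ hφ hψ => by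
    have := norm_tensorPairing_le_leftInjectiveAssociate hα z φ ψ hφ hψ
    rw [hz] at this
    exact norm_le_zero_iff.1 this
  tmul_le E F _ _ _ _ x y := (leftInjectiveAssociate_le hα _).trans (hα.tmul_le E F x y)
  injective_le E F _ _ _ _ z φ ψ hφ hψ :=
    norm_tensorPairing_le_leftInjectiveAssociate hα z φ ψ hφ hψ
  map_le E F G H _ _ _ _ _ _ _ _ S T z := leftInjectiveAssociate_map_le hα S T z

/-- An isometric embedding `I : E → G` makes `ℓ_∞(B_{E'})` a contractive image of `ℓ_∞(B_{G'})`
compatibly with the canonical embeddings: choose norm-preserving extensions of functionals. -/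
theorem isLeftInjective_leftInjectiveAssociate (hα : IsTensorNorm α) :
    IsLeftInjective (leftInjectiveAssociate α) := by
  intro E G F _ _ _ _ _ _ I z
  refine le_antisymm ((isTensorNorm_leftInjectiveAssociate hα).map_id_le I.toContinuousLinearMap
    I.norm_toContinuousLinearMap_le z) ?_
  choose ψ hψ1 hψ2 using exists_comp_eq_of_linearIsometry I
  let ρ : Metric.closedBall (0 : StrongDual 𝕜 E) 1 → Metric.closedBall (0 : StrongDual 𝕜 G) 1 :=
    fun φ => ⟨ψ φ, mem_closedBall_zero_iff.2
      ((hψ1 φ).trans (mem_closedBall_zero_iff.mp φ.2))⟩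
  have e1 : (linftyComp 𝕜 ρ).toLinearMap ∘ₗ evalEmbedding 𝕜 G ∘ₗ I.toLinearMap =
      evalEmbedding 𝕜 E := by
    ext x φ
    exact hψ2 φ x
  have e : TensorProduct.map (evalEmbedding 𝕜 E) (LinearMap.id : F →ₗ[𝕜] F) z =
      TensorProduct.map (linftyComp 𝕜 ρ).toLinearMap LinearMap.id
        (TensorProduct.map (evalEmbedding 𝕜 G) LinearMap.id
          (TensorProduct.map I.toLinearMap LinearMap.id z)) := by
    rw [← e1]
    simp only [← LinearMap.comp_apply, ← TensorProduct.map_comp, LinearMap.id_comp]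
  rw [leftInjectiveAssociate, e]
  exact hα.map_id_le _ (norm_linftyComp_le ρ) _

theorem norm_evalEmbedding (x : E) : ‖evalEmbedding 𝕜 E x‖ = ‖x‖ := by
  refine le_antisymm (((evalEmbeddingL 𝕜 E).le_of_opNorm_le norm_evalEmbeddingL_le x).trans
    (one_mul _).le) ?_
  obtain ⟨φ, hφ, hx⟩ := exists_dual_vector'' 𝕜 x
  have := lp.norm_apply_le_norm ENNReal.top_ne_zero (evalEmbedding 𝕜 E x)
    ⟨φ, mem_closedBall_zero_iff.2 hφ⟩
  rw [evalEmbedding_apply] at this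
  simpa [hx] using this

theorem isLeftInjectiveAssociate_leftInjectiveAssociate (hα : IsTensorNorm α) :
    IsLeftInjectiveAssociate (leftInjectiveAssociate α) α where
  isTensorNorm := isTensorNorm_leftInjectiveAssociate hα
  isLeftInjective := isLeftInjective_leftInjectiveAssociate hα
  le _ _ _ _ _ _ z := leftInjectiveAssociate_le hα z
  greatest γ _ hγ hle E F _ _ _ _ z := by
    rw [← hγ E (LinftyDualBall 𝕜 E) F ⟨evalEmbedding 𝕜 E, norm_evalEmbedding⟩ z]
    exact hle _ _ _

/-- A tensor norm is bounded by its finite hull. -/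
theorem IsTensorNorm.le_finiteHull (hα : IsTensorNorm α) (z : E ⊗[𝕜] F) :
    α E F z ≤ finiteHull α E F z := by
  obtain ⟨M, N, hM, hN, hz⟩ := TensorProduct.exists_finite_submodule_of_setFinite {z}
    (Set.finite_singleton z)
  obtain ⟨w, hw⟩ := hz rfl
  refine le_csInf ⟨_, M, N, w, hM, hN, hw, rfl⟩ ?_
  rintro _ ⟨M, N, w, -, -, rfl, rfl⟩
  exact hα.map_le_of_norm_le_one M.subtypeL N.subtypeL (Submodule.norm_subtypeL_le M)
    (Submodule.norm_subtypeL_le N) w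

theorem IsTensorNorm.finiteHull_le (hα : IsTensorNorm α) (M : Submodule 𝕜 E) (N : Submodule 𝕜 F)
    [FiniteDimensional 𝕜 M] [FiniteDimensional 𝕜 N] (w : M ⊗[𝕜] N) :
    finiteHull α E F (TensorProduct.map M.subtype N.subtype w) ≤ α M N w := by
  refine csInf_le ⟨0, ?_⟩ ⟨M, N, w, inferInstance, inferInstance, rfl, rfl⟩
  rintro _ ⟨M, N, w, -, -, -, rfl⟩
  exact hα.nonneg w

theorem lTensor_subtype_injective {V : Type*} [AddCommGroup V] [Module 𝕜 V]
    (N : Submodule 𝕜 F) : Function.Injective (LinearMap.lTensor V N.subtype) :=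
  Module.Flat.lTensor_preserves_injective_linearMap _ N.injective_subtype

/-- By left injectivity only the right factor has to be made finite-dimensional, and there it is
enough to contain the finitely many vectors of one representation in `ℓ_∞(B_{E'}) ⊗ F`. -/
theorem isFinitelyGenerated_leftInjectiveAssociate_chevetSapharD {p : ℝ≥0∞} (hp : 1 ≤ p) :
    IsFinitelyGenerated.{u} (leftInjectiveAssociate (chevetSapharD 𝕜 p)) := by
  intro E F _ _ _ _ z
  have hd := isTensorNorm_chevetSapharD.{u} (𝕜 := 𝕜) hp
  have hα := isTensorNorm_leftInjectiveAssociate hd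
  have hpq := ENNReal.HolderConjugate.conjExponent hp
  refine le_antisymm (hα.le_finiteHull z) (le_of_forall_gt fun t ht => ?_)
  obtain ⟨t', ht', htt'⟩ := exists_between ht
  refine lt_of_le_of_lt ?_ htt'
  have ht0 := (hα.nonneg z).trans_lt ht'
  obtain ⟨n, x, y, hz, hx, hy⟩ := exists_rep_of_chevetSapharD_lt (p := p) ht'
    (q := ENNReal.conjExponent p)
  obtain ⟨M, N₀, hM, hN₀, hz₀⟩ := TensorProduct.exists_finite_submodule_of_setFinite {z}
    (Set.finite_singleton z)
  obtain ⟨w₀, hw₀⟩ := hz₀ rfl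
  let N := N₀ ⊔ Submodule.span 𝕜 (Set.range y)
  have hfinN : FiniteDimensional 𝕜 N :=
    have := FiniteDimensional.span_of_finite 𝕜 (Set.finite_range y)
    inferInstanceAs (FiniteDimensional 𝕜 ↥(N₀ ⊔ Submodule.span 𝕜 (Set.range y)))
  have hyN : ∀ i, y i ∈ N := fun i =>
    Submodule.mem_sup_right (Submodule.subset_span (Set.mem_range_self i))
  let w : M ⊗[𝕜] N :=
    TensorProduct.map LinearMap.id (Submodule.inclusion (le_sup_left : N₀ ≤ N)) w₀
  have hw : TensorProduct.map M.subtype N.subtype w = z := by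
    rw [← hw₀]
    simp only [w, TensorProduct.mapIncl, ← LinearMap.comp_apply, ← TensorProduct.map_comp]
    rfl
  have hfinM : FiniteDimensional 𝕜 M := hM
  refine (hw ▸ hα.finiteHull_le M N w).trans ?_
  rw [← isLeftInjective_leftInjectiveAssociate hd M E N M.subtypeₗᵢ w]
  refine (chevetSapharD_le (p := p) (q := ENNReal.conjExponent p) (x := x)
    (y := fun i => (⟨y i, hyN i⟩ : N)) (by positivity) (by positivity) ?_ hx
    (hy.mono (by positivity) le_rfl fun _ => le_rfl)).trans
      (rpow_toReal_inv_mul_rpow p _ ht0).le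
  have hinj : Function.Injective (LinearMap.lTensor (LinftyDualBall 𝕜 E) N.subtype) :=
    lTensor_subtype_injective N
  refine hinj ?_
  have e : LinearMap.lTensor (LinftyDualBall 𝕜 E) N.subtype
      (TensorProduct.map (evalEmbedding 𝕜 E) LinearMap.id
        (TensorProduct.map M.subtypeₗᵢ.toLinearMap LinearMap.id w)) =
      TensorProduct.map (evalEmbedding 𝕜 E) LinearMap.id z := by
    rw [← hw]
    simp only [LinearMap.lTensor, ← LinearMap.comp_apply, ← TensorProduct.map_comp]
    rfl
  rw [e, hz]
  simp

end LeftInjectiveAssociate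

/-! ### Duality between `/d_p` and `g_q` -/

section Duality

variable {𝕜 : Type} [RCLike 𝕜] {p q : ℝ≥0∞} [hpq : p.HolderConjugate q]
  {E F : Type u} [NormedAddCommGroup E] [NormedSpace 𝕜 E] [NormedAddCommGroup F] [NormedSpace 𝕜 F]

theorem chevetSapharG_le {ι : Type*} [Fintype ι] {z : E ⊗[𝕜] F} {x : ι → E} {y : ι → F}
    {A B : ℝ} (hA : 0 ≤ A) (hB : 0 ≤ B) (hz : z = ∑ i, x i ⊗ₜ[𝕜] y i) (hx : LpBound q A x)
    (hy : WeakBound 𝕜 p B y) : chevetSapharG 𝕜 q E F z ≤ A * B := by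
  let e := (Fintype.equivFin ι).symm
  have hp1 := ENNReal.HolderConjugate.one_le p q
  have hq1 := ENNReal.HolderConjugate.one_le q p
  have hc := ENNReal.HolderConjugate.conjExponent_eq (p := q) (q := p)
  have hbdd : BddBelow {c : ℝ | ∃ (n : ℕ) (x : Fin n → E) (y : Fin n → F),
      z = ∑ i, x i ⊗ₜ[𝕜] y i ∧
        c = strongNorm q x * weakNorm 𝕜 (ENNReal.conjExponent q) y} := by
    refine ⟨0, ?_⟩
    rintro _ ⟨n, x, y, -, rfl⟩
    rw [hc]
    exact mul_nonneg (strongNorm_nonneg hq1 x) (weakNorm_nonneg hp1 y)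
  refine (csInf_le hbdd ⟨_, x ∘ e, y ∘ e, ?_, rfl⟩).trans ?_
  · rw [hz]
    exact (e.sum_comp fun i => x i ⊗ₜ[𝕜] y i).symm
  · rw [hc]
    exact mul_le_mul ((strongNorm_le_iff hq1 hA).2 (hx.comp_injective e.injective))
      ((weakNorm_le_iff hp1 hB).2 (hy.comp_injective e.injective)) (weakNorm_nonneg hp1 _) hA

theorem exists_rep_of_chevetSapharG_lt {z : E ⊗[𝕜] F} {t : ℝ}
    (ht : chevetSapharG 𝕜 q E F z < t) :
    ∃ (n : ℕ) (x : Fin n → E) (y : Fin n → F) (A B : ℝ), z = ∑ i, x i ⊗ₜ[𝕜] y i ∧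
      0 ≤ A ∧ 0 ≤ B ∧ A * B < t ∧ LpBound q A x ∧ WeakBound 𝕜 p B y := by
  have hp1 := ENNReal.HolderConjugate.one_le p q
  have hq1 := ENNReal.HolderConjugate.one_le q p
  obtain ⟨n₀, x₀, y₀, h₀⟩ := TensorProduct.exists_sum_tmul_eq z
  have hne : Set.Nonempty {c : ℝ | ∃ (n : ℕ) (x : Fin n → E) (y : Fin n → F),
      z = ∑ i, x i ⊗ₜ[𝕜] y i ∧ c = strongNorm q x * weakNorm 𝕜 (ENNReal.conjExponent q) y} :=
    ⟨_, n₀, x₀, y₀, h₀, rfl⟩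
  obtain ⟨_, ⟨n, x, y, hz, rfl⟩, hlt⟩ := exists_lt_of_csInf_lt hne ht
  rw [ENNReal.HolderConjugate.conjExponent_eq (p := q) (q := p)] at hlt
  have hA := strongNorm_nonneg hq1 x
  have hB := weakNorm_nonneg (𝕜 := 𝕜) hp1 y
  exact ⟨n, x, y, _, _, hz, hA, hB, hlt, (strongNorm_le_iff hq1 hA).1 le_rfl,
    (weakNorm_le_iff hp1 hB).1 le_rfl⟩

theorem norm_inv_norm_smul_le {V : Type*} [NormedAddCommGroup V] [NormedSpace 𝕜 V] (v : V) :
    ‖(‖v‖ : 𝕜)⁻¹ • v‖ ≤ 1 := by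
  rw [norm_smul, norm_inv, RCLike.norm_ofReal, abs_norm]
  exact inv_mul_le_one_of_le₀ le_rfl (norm_nonneg v)

theorem norm_smul_inv_norm_smul {V : Type*} [NormedAddCommGroup V] [NormedSpace 𝕜 V] (v : V) :
    (‖v‖ : 𝕜) • (‖v‖ : 𝕜)⁻¹ • v = v := by
  rcases eq_or_ne v 0 with rfl | hv
  · simp
  · rw [smul_inv_smul₀ (by simpa using hv)]

/-- The doubly indexed family `ψ_i(y_j)` has `ℓ_p` norm at most the product of the weak norm of
`ψ` and the strong norm of `y`. -/
theorem lpBound_apply_prod {ι κ : Type*} {ψ : ι → StrongDual 𝕜 F} {y : κ → F} {B b : ℝ}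
    (hB : 0 ≤ B) (hb : 0 ≤ b) (hψ : WeakBound 𝕜 p B ψ) (hy : LpBound p b y) :
    LpBound p (b * B) fun ij : κ × ι => ψ ij.2 (y ij.1) := by
  refine LpBound.prod (h := fun j i => ψ i ((‖y j‖ : 𝕜)⁻¹ • y j)) hb hB hy (fun j => ?_)
    fun j i => ?_
  · refine hψ (NormedSpace.inclusionInDoubleDual 𝕜 F ((‖y j‖ : 𝕜)⁻¹ • y j)) ?_
    exact (NormedSpace.double_dual_bound 𝕜 F _).trans (norm_inv_norm_smul_le (y j))
  · have h : ψ i (y j) = (‖y j‖ : 𝕜) * ψ i ((‖y j‖ : 𝕜)⁻¹ • y j) := by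
      conv_lhs => rw [← norm_smul_inv_norm_smul (𝕜 := 𝕜) (y j), map_smul, smul_eq_mul]
    dsimp only
    rw [h, norm_mul, RCLike.norm_ofReal, abs_norm]

/-- The pairing of `E ⊗ F` with `E' ⊗ F'` is bounded by the product of `/d_p` and `g_q`: a
representation of the tensor in `ℓ_∞(B_{E'}) ⊗ F` is evaluated at the normalized left factors of
the functional, and Hölder's inequality is applied to the double sum. -/
theorem norm_tensorPairing_le_mul (z : E ⊗[𝕜] F) (w : StrongDual 𝕜 E ⊗[𝕜] StrongDual 𝕜 F)
    {s t : ℝ} (hs : leftInjectiveAssociate (chevetSapharD 𝕜 p) E F z < s)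
    (ht : chevetSapharG 𝕜 q (StrongDual 𝕜 E) (StrongDual 𝕜 F) w < t) :
    ‖tensorPairing 𝕜 E F z w‖ ≤ s * t := by
  have hp1 := ENNReal.HolderConjugate.one_le p q
  have hs0 : 0 < s := (chevetSapharD_nonneg hp1 _).trans_lt hs
  obtain ⟨n, φ, ψ, A, B, rfl, hA, hB, hAB, hφ, hψ⟩ := exists_rep_of_chevetSapharG_lt (p := p) ht
  obtain ⟨m, x, y, hz, hx, hy⟩ := exists_rep_of_chevetSapharD_lt (q := q) hs
  let θ : Fin n → Metric.closedBall (0 : StrongDual 𝕜 E) 1 := fun i =>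
    ⟨(‖φ i‖ : 𝕜)⁻¹ • φ i, mem_closedBall_zero_iff.2 (norm_inv_norm_smul_le (φ i))⟩
  have key : ∀ i, leftSlice F (φ i) z = (‖φ i‖ : 𝕜) • ∑ j, x j (θ i) • y j := by
    intro i
    conv_lhs => rw [← norm_smul_inv_norm_smul (𝕜 := 𝕜) (φ i), leftSlice_smul]
    congr 1
    have := leftSlice_linftyEval_map_evalEmbedding (θ i) z
    rw [hz, leftSlice_sum_tmul] at this
    exact this.symm
  have hf : LpBound q (A * s ^ q.toReal⁻¹)
      fun ij : Fin n × Fin m => (‖φ ij.1‖ : 𝕜) * x ij.2 (θ ij.1) :=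
    LpBound.prod (h := fun i j => x j (θ i)) hA (by positivity) hφ
      (fun i => hx (linftyEval (θ i)) (norm_linftyEval_le _)) fun i j => by simp
  have hg := lpBound_apply_prod hB (by positivity) hψ hy
  have hf' := hf.comp_injective (e := (Prod.swap : Fin m × Fin n → _)) Prod.swap_injective
  have hH := hf'.sum_mul_le (p := q) (q := p) (by positivity) (by positivity) hg Finset.univ
  rw [tensorPairing_sum_tmul]
  calc ‖∑ i, ψ i (leftSlice F (φ i) z)‖
      = ‖∑ ij : Fin m × Fin n, ((‖φ ij.2‖ : 𝕜) * x ij.1 (θ ij.2)) * ψ ij.2 (y ij.1)‖ := by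
        rw [Fintype.sum_prod_type_right]
        congr 1
        refine Finset.sum_congr rfl fun i _ => ?_
        rw [key, map_smul, map_sum, Finset.smul_sum]
        refine Finset.sum_congr rfl fun j _ => ?_
        rw [map_smul, smul_eq_mul, smul_eq_mul, mul_assoc]
    _ ≤ ∑ ij : Fin m × Fin n, ‖(‖φ ij.2‖ : 𝕜) * x ij.1 (θ ij.2)‖ * ‖ψ ij.2 (y ij.1)‖ := by
        refine (norm_sum_le _ _).trans (Finset.sum_le_sum fun i _ => ?_)
        rw [norm_mul]
    _ ≤ A * s ^ q.toReal⁻¹ * (s ^ p.toReal⁻¹ * B) := hH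
    _ = (A * B) * (s ^ q.toReal⁻¹ * s ^ p.toReal⁻¹) := by ring
    _ = A * B * s := by rw [rpow_toReal_inv_mul_rpow p q hs0]
    _ ≤ s * t := by rw [mul_comm]; gcongr

end Duality

/-! ### Pietsch factorization over a finite set -/

section Pietsch

variable {ι : Type*} [Fintype ι]

/-- A convex cone in `ℝ^ι` none of whose elements has all coordinates negative lies on the
nonnegative side of some probability vector. -/
theorem exists_probability_of_cone [Nonempty ι] (C : Set (ι → ℝ)) (h0 : (0 : ι → ℝ) ∈ C)
    (hadd : ∀ f ∈ C, ∀ g ∈ C, f + g ∈ C) (hsmul : ∀ a : ℝ, 0 ≤ a → ∀ f ∈ C, a • f ∈ C)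
    (hC : ∀ f ∈ C, ∃ j, 0 ≤ f j) :
    ∃ l : ι → ℝ, (∀ j, 0 ≤ l j) ∧ ∑ j, l j = 1 ∧ ∀ f ∈ C, 0 ≤ ∑ j, l j * f j := by
  classical
  have hconv : Convex ℝ C := fun f hf g hg a b ha hb _ =>
    hadd _ (hsmul a ha f hf) _ (hsmul b hb g hg)
  let O : Set (ι → ℝ) := Set.pi Set.univ fun _ => Set.Iio 0
  have hO : ∀ {f : ι → ℝ}, f ∈ O ↔ ∀ j, f j < 0 := by simp [O]
  obtain ⟨L, u, h1, h2⟩ := geometric_hahn_banach_open (s := O) (t := C)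
    (convex_pi fun _ _ => convex_Iio 0) (isOpen_set_pi Set.finite_univ fun _ _ => isOpen_Iio)
    hconv (Set.disjoint_left.2 fun f hf hf' => by
      obtain ⟨j, hj⟩ := hC f hf'
      exact absurd (hO.1 hf j) (not_lt.2 hj))
  have hu : u ≤ 0 := by simpa using h2 0 h0
  have hneg : ∀ f ∈ O, L f < 0 := fun f hf => (h1 f hf).trans_le hu
  have h1pos : 0 < L 1 := by
    have := hneg (-1) (hO.2 fun j => by simp)
    rw [map_neg] at this
    linarith
  have hL : ∀ f : ι → ℝ, L f = ∑ j, f j * L (Pi.single j 1) := by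
    intro f
    conv_lhs => rw [← Finset.univ_sum_single f, map_sum]
    refine Finset.sum_congr rfl fun j _ => ?_
    rw [← smul_eq_mul, ← map_smul, ← Pi.single_smul, smul_eq_mul, mul_one]
  have hpos : ∀ j, 0 ≤ L (Pi.single j 1) := by
    intro j
    by_contra! hj
    have hε : 0 < -L (Pi.single j 1) / (2 * L 1) := div_pos (by linarith) (by linarith)
    have := hneg (-Pi.single j 1 - (-L (Pi.single j 1) / (2 * L 1)) • (1 : ι → ℝ)) (hO.2 fun i => by
      have : (0 : ℝ) ≤ (Pi.single j 1 : ι → ℝ) i := by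
        rw [Pi.single_apply]; split_ifs <;> simp
      simp only [Pi.sub_apply, Pi.neg_apply, Pi.smul_apply, Pi.one_apply, smul_eq_mul, mul_one]
      linarith)
    rw [map_sub, map_neg, map_smul, smul_eq_mul] at this
    have e : -L (Pi.single j 1) / (2 * L 1) * L 1 = -L (Pi.single j 1) / 2 := by
      field_simp
    rw [e] at this
    linarith
  have hCpos : ∀ f ∈ C, 0 ≤ L f := by
    intro f hf
    by_contra! hlt
    have := h1 ((L f / L 1) • (1 : ι → ℝ)) (hO.2 fun j => by
      simpa using div_neg_of_neg_of_pos hlt h1pos)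
    rw [map_smul, smul_eq_mul, div_mul_cancel₀ _ h1pos.ne'] at this
    exact absurd (h2 f hf) (not_le.2 this)
  refine ⟨fun j => L (Pi.single j 1) / L 1, fun j => div_nonneg (hpos j) h1pos.le, ?_, ?_⟩
  · rw [← Finset.sum_div, div_eq_one_iff_eq h1pos.ne', hL 1]
    simp
  · intro f hf
    have : ∑ j, L (Pi.single j 1) / L 1 * f j = L f / L 1 := by
      rw [hL f, Finset.sum_div]
      exact Finset.sum_congr rfl fun j _ => by ring
    rw [this]
    exact div_nonneg (hCpos f hf) h1pos.le

variable {𝕜 : Type} [RCLike 𝕜] {p q : ℝ≥0∞} [hpq : p.HolderConjugate q]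
  {N : Type u} [NormedAddCommGroup N] [NormedSpace 𝕜 N]

/-- Pietsch domination for finite `p` and `q`, in a form which is already split by Young's
inequality: the left-hand side and the functional scale alike, so the admissible differences form
a cone to which `exists_probability_of_cone` applies. -/
theorem exists_pietsch_probability [Nonempty ι] {P Q : ℝ} (hPQ : P.HolderConjugate Q)
    (T : ι → StrongDual 𝕜 N)
    (H : ∀ (κ : Type) [Fintype κ] (x : κ → ι → 𝕜) (y : κ → N) (A B : ℝ), 0 ≤ A → 0 ≤ B →
      (∀ j, ∑ k, ‖x k j‖ ^ Q ≤ A ^ Q) → ∑ k, ‖y k‖ ^ P ≤ B ^ P →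
      ‖∑ k, ∑ j, x k j * T j (y k)‖ ≤ A * B) :
    ∃ l : ι → ℝ, (∀ j, 0 ≤ l j) ∧ ∑ j, l j = 1 ∧ ∀ (x : ι → 𝕜) (y : N),
      RCLike.re (∑ j, x j * T j y) ≤ (∑ j, l j * ‖x j‖ ^ Q) / Q + ‖y‖ ^ P / P := by
  classical
  let G : (κ : Type) → [Fintype κ] → (κ → ι → 𝕜) → (κ → N) → ι → ℝ := fun κ _ x y j =>
    (∑ k, ‖x k j‖ ^ Q) / Q + (∑ k, ‖y k‖ ^ P) / P - RCLike.re (∑ k, ∑ j, x k j * T j (y k))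
  let C : Set (ι → ℝ) := {f | ∃ (κ : Type) (_ : Fintype κ) (x : κ → ι → 𝕜) (y : κ → N),
    f = G κ x y}
  have hadd : ∀ f ∈ C, ∀ g ∈ C, f + g ∈ C := by
    rintro _ ⟨κ, _, x, y, rfl⟩ _ ⟨κ', _, x', y', rfl⟩
    refine ⟨κ ⊕ κ', inferInstance, Sum.elim x x', Sum.elim y y', ?_⟩
    ext j
    simp only [G, Pi.add_apply, Fintype.sum_sum_type, Sum.elim_inl, Sum.elim_inr, map_add]
    ring
  have hsmul : ∀ a : ℝ, 0 ≤ a → ∀ f ∈ C, a • f ∈ C := by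
    rintro a ha _ ⟨κ, _, x, y, rfl⟩
    refine ⟨κ, inferInstance, fun k j => ((a ^ Q⁻¹ : ℝ) : 𝕜) * x k j,
      fun k => ((a ^ P⁻¹ : ℝ) : 𝕜) • y k, ?_⟩
    have haQ : 0 ≤ a ^ Q⁻¹ := Real.rpow_nonneg ha _
    have haP : 0 ≤ a ^ P⁻¹ := Real.rpow_nonneg ha _
    have hmul : a ^ Q⁻¹ * a ^ P⁻¹ = a := by
      rw [← Real.rpow_add_of_nonneg ha hPQ.symm.inv_nonneg hPQ.inv_nonneg,
        hPQ.symm.inv_add_inv_eq_one, Real.rpow_one]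
    have hmul' : (a : 𝕜) = ((a ^ Q⁻¹ : ℝ) : 𝕜) * ((a ^ P⁻¹ : ℝ) : 𝕜) := by
      rw [← RCLike.ofReal_mul, hmul]
    have e1 : ∀ c : 𝕜, ‖((a ^ Q⁻¹ : ℝ) : 𝕜) * c‖ ^ Q = a * ‖c‖ ^ Q := fun c => by
      rw [norm_mul, RCLike.norm_ofReal, abs_of_nonneg haQ, Real.mul_rpow haQ (norm_nonneg _),
        Real.rpow_inv_rpow ha hPQ.symm.ne_zero]
    have e2 : ∀ v : N, ‖((a ^ P⁻¹ : ℝ) : 𝕜) • v‖ ^ P = a * ‖v‖ ^ P := fun c => by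
      rw [norm_smul, RCLike.norm_ofReal, abs_of_nonneg haP, Real.mul_rpow haP (norm_nonneg _),
        Real.rpow_inv_rpow ha hPQ.ne_zero]
    have e3 : ∑ k, ∑ j, ((a ^ Q⁻¹ : ℝ) : 𝕜) * x k j * T j (((a ^ P⁻¹ : ℝ) : 𝕜) • y k) =
        (a : 𝕜) * ∑ k, ∑ j, x k j * T j (y k) := by
      simp_rw [Finset.mul_sum]
      refine Finset.sum_congr rfl fun k _ => Finset.sum_congr rfl fun j _ => ?_
      rw [map_smul, smul_eq_mul]
      linear_combination (-(x k j * T j (y k))) * hmul'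
    ext j
    simp only [G, Pi.smul_apply, smul_eq_mul, e1, e2, e3, RCLike.re_ofReal_mul, ← Finset.mul_sum]
    ring
  have hneg : ∀ f ∈ C, ∃ j, 0 ≤ f j := by
    rintro _ ⟨κ, _, x, y, rfl⟩
    obtain ⟨j, hj⟩ := Finite.exists_max fun j => ∑ k, ‖x k j‖ ^ Q
    refine ⟨j, ?_⟩
    have hS : 0 ≤ ∑ k, ‖x k j‖ ^ Q := by positivity
    have hR : 0 ≤ ∑ k, ‖y k‖ ^ P := by positivity
    have h := H κ x y ((∑ k, ‖x k j‖ ^ Q) ^ Q⁻¹) ((∑ k, ‖y k‖ ^ P) ^ P⁻¹)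
      (by positivity) (by positivity)
      (fun i => by rw [Real.rpow_inv_rpow hS hPQ.symm.ne_zero]; exact hj i)
      (by rw [Real.rpow_inv_rpow hR hPQ.ne_zero])
    have hY := Real.young_inequality_of_nonneg (Real.rpow_nonneg hS Q⁻¹) (Real.rpow_nonneg hR P⁻¹)
      hPQ.symm
    rw [Real.rpow_inv_rpow hS hPQ.symm.ne_zero, Real.rpow_inv_rpow hR hPQ.ne_zero] at hY
    have := RCLike.re_le_norm (∑ k, ∑ j, x k j * T j (y k))
    simp only [G]
    linarith
  obtain ⟨l, hl0, hl1, hl⟩ := exists_probability_of_cone C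
    ⟨Empty, inferInstance, Empty.elim, Empty.elim, by ext j; simp [G]⟩ hadd hsmul hneg
  refine ⟨l, hl0, hl1, fun x y => ?_⟩
  have := hl _ ⟨Unit, inferInstance, fun _ => x, fun _ => y, rfl⟩
  simp only [G, Finset.univ_unique, Finset.sum_const, Finset.card_singleton, one_smul] at this
  have e : ∑ j, l j * (‖x j‖ ^ Q / Q + ‖y‖ ^ P / P - RCLike.re (∑ j, x j * T j y)) =
      (∑ j, l j * ‖x j‖ ^ Q) / Q + (∑ j, l j) * (‖y‖ ^ P / P) -
        (∑ j, l j) * RCLike.re (∑ j, x j * T j y) := by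
    rw [Finset.sum_div, Finset.sum_mul, Finset.sum_mul, ← Finset.sum_add_distrib,
      ← Finset.sum_sub_distrib]
    exact Finset.sum_congr rfl fun j _ => by ring
  rw [e, hl1] at this
  linarith

theorem opNorm_le_of_forall_norm_le_one {V V' : Type*} [NormedAddCommGroup V] [NormedSpace 𝕜 V]
    [NormedAddCommGroup V'] [NormedSpace 𝕜 V'] {f : V →L[𝕜] V'} {C : ℝ} (hC : 0 ≤ C)
    (h : ∀ v, ‖v‖ ≤ 1 → ‖f v‖ ≤ C) : ‖f‖ ≤ C := by
  refine f.opNorm_le_bound hC fun v => ?_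
  rw [← norm_smul_inv_norm_smul (𝕜 := 𝕜) v, map_smul, norm_smul, RCLike.norm_ofReal, abs_norm,
    norm_smul_inv_norm_smul, mul_comm C]
  exact mul_le_mul_of_nonneg_left (h _ (norm_inv_norm_smul_le v)) (norm_nonneg v)

/-- **Pietsch factorization** on `ℓ_∞^ι`: functionals `T_j` which pair with tensors in
`ℓ_∞^ι ⊗ N` within the bound of `d_p` factor as `T_j = μ_j T'_j` with `μ` in the unit ball of
`ℓ_q` and `T'` weakly `p`-summable with norm at most one. -/
theorem exists_pietsch_factorization [Nonempty ι] (hp : p ≠ ∞) (T : ι → StrongDual 𝕜 N)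
    (H : ∀ (κ : Type) [Fintype κ] (x : κ → ι → 𝕜) (y : κ → N) (A B : ℝ), 0 ≤ A → 0 ≤ B →
      (∀ j, LpBound q A fun k => x k j) → LpBound p B y →
      ‖∑ k, ∑ j, x k j * T j (y k)‖ ≤ A * B) :
    ∃ (μ : ι → ℝ) (T' : ι → StrongDual 𝕜 N), LpBound q 1 μ ∧ WeakBound 𝕜 p 1 T' ∧
      ∀ j, T j = (μ j : 𝕜) • T' j := by
  classical
  have hp1 := ENNReal.HolderConjugate.one_le p q
  rcases eq_or_ne q ∞ with rfl | hq
  · refine ⟨fun _ => 1, T, lpBound_top.2 (by simp), ?_, by simp⟩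
    refine WeakBound.of_forall_sum_smul (q := ∞) zero_le_one fun b hb =>
      ContinuousLinearMap.opNorm_le_bound _ zero_le_one fun y => ?_
    have := H Unit (fun _ => b) (fun _ => y) 1 ‖y‖ zero_le_one (norm_nonneg _)
      (fun j => lpBound_top.2 fun _ => lpBound_top.1 hb j) (lpBound_unit hp1 y)
    simpa using this
  have hPQ := ENNReal.HolderConjugate.toReal_of_ne_top (p := p) (q := q) hp hq
  set P := p.toReal
  set Q := q.toReal with hQ
  obtain ⟨l, hl0, hl1, hl⟩ := exists_pietsch_probability hPQ T fun κ _ x y A B hA hB hx hy =>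
    H κ x y A B hA hB (fun j => (lpBound_iff_univ hq).2 (hx j)) ((lpBound_iff_univ hp).2 hy)
  let μ : ι → ℝ := fun j => l j ^ Q⁻¹
  have hμ0 : ∀ j, 0 ≤ μ j := fun j => Real.rpow_nonneg (hl0 j) _
  have hμ : ∀ j, μ j ^ Q = l j := fun j => Real.rpow_inv_rpow (hl0 j) hPQ.symm.ne_zero
  refine ⟨μ, fun j => (μ j : 𝕜)⁻¹ • T j, ?_, ?_, fun j => ?_⟩
  · rw [lpBound_iff_univ hq, Real.one_rpow, ← hl1]
    refine (Finset.sum_congr rfl fun j _ => ?_).le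
    rw [Real.norm_of_nonneg (hμ0 j), ← hQ, hμ]
  · refine WeakBound.of_forall_sum_smul (q := q) zero_le_one fun b hb =>
      opNorm_le_of_forall_norm_le_one zero_le_one fun y hy => ?_
    rw [lpBound_iff_univ hq, Real.one_rpow] at hb
    have e : (∑ j, b j • (μ j : 𝕜)⁻¹ • T j) y = ∑ j, (b j * (μ j : 𝕜)⁻¹) * T j y := by
      simp [mul_assoc]
    rw [e]
    obtain ⟨c, hc1, hc⟩ := exists_norm_le_one_mul_eq_norm (∑ j, (b j * (μ j : 𝕜)⁻¹) * T j y)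
    have h := hl (fun j => c * (b j * (μ j : 𝕜)⁻¹)) y
    have e2 : ∑ j, c * (b j * (μ j : 𝕜)⁻¹) * T j y =
        (‖∑ j, (b j * (μ j : 𝕜)⁻¹) * T j y‖ : 𝕜) := by
      rw [← hc, mul_comm _ c, Finset.mul_sum]
      exact Finset.sum_congr rfl fun j _ => by ring
    rw [e2, RCLike.ofReal_re] at h
    have h1 : ∑ j, l j * ‖c * (b j * (μ j : 𝕜)⁻¹)‖ ^ Q ≤ 1 := by
      refine le_trans (Finset.sum_le_sum fun j _ => ?_) hb
      rw [← hμ j, ← Real.mul_rpow (hμ0 j) (norm_nonneg _)]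
      refine Real.rpow_le_rpow (by have := hμ0 j; positivity) ?_ hPQ.symm.nonneg
      rw [norm_mul, norm_mul, norm_inv, RCLike.norm_ofReal, abs_of_nonneg (hμ0 j)]
      calc μ j * (‖c‖ * (‖b j‖ * (μ j)⁻¹)) = ‖c‖ * ‖b j‖ * (μ j * (μ j)⁻¹) := by ring
        _ ≤ 1 * ‖b j‖ * 1 := by
            gcongr
            · exact mul_nonneg (hμ0 j) (inv_nonneg.2 (hμ0 j))
            · exact mul_inv_le_one
        _ = ‖b j‖ := by ring
    have h2 : ‖y‖ ^ P ≤ 1 := Real.rpow_le_one (norm_nonneg _) hy hPQ.nonneg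
    calc _ ≤ _ := h
      _ ≤ 1 / Q + 1 / P := by
          have := hPQ.pos
          have := hPQ.symm.pos
          gcongr
      _ = 1 := by rw [one_div, one_div, hPQ.symm.inv_add_inv_eq_one]
  · rcases eq_or_ne (μ j) 0 with h0 | h0
    · -- a coordinate of mass zero does not contribute, since it may be scaled freely
      have hlj : l j = 0 := by rw [← hμ j, h0, Real.zero_rpow hPQ.symm.ne_zero]
      ext y
      change T j y = (μ j : 𝕜) * ((μ j : 𝕜)⁻¹ * T j y)
      rw [h0, RCLike.ofReal_zero, zero_mul]
      by_contra hne
      have hpos : 0 < ‖T j y‖ := norm_pos_iff.2 hne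
      obtain ⟨c, -, hc⟩ := exists_norm_le_one_mul_eq_norm (T j y)
      set D := ‖y‖ ^ P / P with hD
      have hD0 : 0 ≤ D := div_nonneg (by positivity) hPQ.nonneg
      have h := hl (Pi.single j ((((D + 1) / ‖T j y‖ : ℝ) : 𝕜) * c)) y
      have e1 : ∑ i, (Pi.single j ((((D + 1) / ‖T j y‖ : ℝ) : 𝕜) * c) : ι → 𝕜) i * T i y =
          ((D + 1 : ℝ) : 𝕜) := by
        rw [Finset.sum_eq_single j (fun i _ hi => by simp [hi]) (by simp), Pi.single_eq_same,
          mul_assoc, mul_comm c, hc, ← RCLike.ofReal_mul, div_mul_cancel₀ _ hpos.ne']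
      have e2 : ∑ i, l i * ‖(Pi.single j ((((D + 1) / ‖T j y‖ : ℝ) : 𝕜) * c) : ι → 𝕜) i‖ ^ Q
          = 0 := by
        refine Finset.sum_eq_zero fun i _ => ?_
        rcases eq_or_ne i j with rfl | hi
        · rw [hlj, zero_mul]
        · rw [Pi.single_eq_of_ne hi, norm_zero, Real.zero_rpow hPQ.symm.ne_zero, mul_zero]
      rw [e1, e2, RCLike.ofReal_re, zero_div, ← hD] at h
      linarith
    · rw [smul_inv_smul₀ (by simpa using h0)]

end Pietsch

/-! ### The equality `/d_p = g_q'` -/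

section Equality

variable {𝕜 : Type} [RCLike 𝕜] {p q : ℝ≥0∞} [hpq : p.HolderConjugate q]

/-- Hahn-Banach for a tensor norm: some functional on `E ⊗ F` dominated by `α` attains `α z`. -/
theorem IsTensorNorm.exists_dual_vector {α : TensorFamily.{u} 𝕜} (hα : IsTensorNorm α)
    {E F : Type u} [NormedAddCommGroup E] [NormedSpace 𝕜 E] [NormedAddCommGroup F]
    [NormedSpace 𝕜 F] (z : E ⊗[𝕜] F) :
    ∃ W : E ⊗[𝕜] F →ₗ[𝕜] 𝕜, W z = (α E F z : 𝕜) ∧ ∀ v, ‖W v‖ ≤ α E F v := by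
  let N : Seminorm 𝕜 (E ⊗[𝕜] F) := Seminorm.of (α E F) (hα.add_le E F) (hα.smul_eq E F)
  rcases eq_or_ne z 0 with rfl | hz
  · refine ⟨0, ?_, fun v => by simpa using hα.nonneg v⟩
    have := hα.smul_eq E F 0 0
    simp only [norm_zero, zero_mul, zero_smul] at this
    simp [this]
  let e := LinearEquiv.toSpanNonzeroSingleton 𝕜 (E ⊗[𝕜] F) z hz
  obtain ⟨W, hW1, hW2⟩ := Module.Dual.exists_extension_of_le_seminorm (𝕜 ∙ z)
    ((α E F z : 𝕜) • e.symm.toLinearMap) (p := N) fun x => by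
      obtain ⟨c, rfl⟩ := e.surjective x
      have h : N (e c : E ⊗[𝕜] F) = ‖c‖ * α E F z := hα.smul_eq E F c z
      rw [h]
      simp [norm_smul, abs_of_nonneg (hα.nonneg z), mul_comm]
  refine ⟨W, ?_, hW2⟩
  have h1 : (e 1 : E ⊗[𝕜] F) = z := one_smul 𝕜 z
  have := hW1 (e 1)
  rw [h1] at this
  simpa [RCLike.real_smul_eq_coe_mul] using this

/-- A functional on `ℓ_∞^ι ⊗ N` dominated by `d_p` is the pairing with a family in `N'`, and this
family factors as in Pietsch's theorem. -/
theorem exists_factorization_of_le_chevetSapharD {ι N : Type u} [Fintype ι] [Nonempty ι]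
    [NormedAddCommGroup N] [NormedSpace 𝕜 N] (hp : p ≠ ∞)
    (W : lp (fun _ : ι => 𝕜) ∞ ⊗[𝕜] N →ₗ[𝕜] 𝕜) (hW : ∀ v, ‖W v‖ ≤ chevetSapharD 𝕜 p _ N v) :
    ∃ (μ : ι → ℝ) (T' : ι → StrongDual 𝕜 N), LpBound q 1 μ ∧ WeakBound 𝕜 p 1 T' ∧
      ∀ v, W v = ∑ j, (μ j : 𝕜) * T' j (leftSlice N (linftyEval j) v) := by
  classical
  have hp1 := ENNReal.HolderConjugate.one_le p q
  let T : ι → StrongDual 𝕜 N := fun j =>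
    LinearMap.mkContinuous (W ∘ₗ TensorProduct.mk 𝕜 _ N (lp.single ∞ j (1 : 𝕜))) 1 fun y => by
      refine (hW _).trans (((isTensorNorm_chevetSapharD hp1).tmul_le _ _ _ _).trans ?_)
      rw [lp.norm_single (by simp), norm_one]
  have hT : ∀ j y, T j y = W (lp.single ∞ j (1 : 𝕜) ⊗ₜ[𝕜] y) := fun _ _ => rfl
  have hsum : ∀ f : lp (fun _ : ι => 𝕜) ∞, f = ∑ j, f j • lp.single ∞ j (1 : 𝕜) := by
    intro f
    ext i
    rw [← linftyEval_apply, ← linftyEval_apply, map_sum]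
    simp [lp.single_apply, Pi.single_apply]
  have hWT : ∀ (f : lp (fun _ : ι => 𝕜) ∞) (y : N), W (f ⊗ₜ[𝕜] y) = ∑ j, f j * T j y := by
    intro f y
    conv_lhs => rw [hsum f, TensorProduct.sum_tmul, map_sum]
    refine Finset.sum_congr rfl fun j _ => ?_
    rw [← TensorProduct.smul_tmul', map_smul, hT, smul_eq_mul]
  obtain ⟨μ, T', hμ, hT', hfac⟩ := exists_pietsch_factorization (q := q) hp T
    fun κ _ x y A B hA hB hx hy => by
      let f : κ → lp (fun _ : ι => 𝕜) ∞ := fun k => ⟨x k, memℓp_infty (Set.finite_range _).bddAbove⟩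
      have e : ∑ k, ∑ j, x k j * T j (y k) = W (∑ k, f k ⊗ₜ[𝕜] y k) := by
        rw [map_sum]
        exact Finset.sum_congr rfl fun k _ => (hWT (f k) (y k)).symm
      rw [e]
      exact (hW _).trans (chevetSapharD_le hA hB rfl
        (WeakBound.of_forall_apply (p := p) hA hx) hy)
  refine ⟨μ, T', hμ, hT', fun v => ?_⟩
  induction v with
  | zero => simp
  | tmul f y =>
    rw [hWT]
    refine Finset.sum_congr rfl fun j _ => ?_
    rw [leftSlice_tmul, hfac, map_smul, linftyEval_apply, smul_apply,
      smul_eq_mul, smul_eq_mul]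
    ring
  | add v w hv hw => simp only [map_add, hv, hw, mul_add, Finset.sum_add_distrib]

/-- Over a finite-dimensional left factor the supremum defining the dual norm of `g_q` almost
attains `/d_p`. The ball of `M'` is replaced by a finite `δ`-net `ι`, which changes the norm by at
most `δ * d_p z`, and on `ℓ_∞^ι ⊗ N` the norming functionals of `d_p` are given by Pietsch
factorization. -/
theorem exists_tensorPairing_ge {M N : Type u} [NormedAddCommGroup M] [NormedSpace 𝕜 M]
    [FiniteDimensional 𝕜 M] [NormedAddCommGroup N] [NormedSpace 𝕜 N] (hp : p ≠ ∞)
    (z : M ⊗[𝕜] N) {δ : ℝ} (hδ : 0 < δ) :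
    ∃ w : StrongDual 𝕜 M ⊗[𝕜] StrongDual 𝕜 N,
      chevetSapharG 𝕜 q (StrongDual 𝕜 M) (StrongDual 𝕜 N) w ≤ 1 ∧
      leftInjectiveAssociate (chevetSapharD 𝕜 p) M N z ≤
        ‖tensorPairing 𝕜 M N z w‖ + δ * chevetSapharD 𝕜 p M N z := by
  have hp1 := ENNReal.HolderConjugate.one_le p q
  have hd := isTensorNorm_chevetSapharD.{u} (𝕜 := 𝕜) hp1
  have : ProperSpace (StrongDual 𝕜 M) := FiniteDimensional.proper 𝕜 _
  obtain ⟨t, hts, htfin, hcov⟩ :=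
    (isCompact_closedBall (0 : StrongDual 𝕜 M) 1).finite_cover_balls hδ
  have hι : Fintype t := htfin.fintype
  have hj : ∀ φ : Metric.closedBall (0 : StrongDual 𝕜 M) 1, ∃ j : t,
      dist (φ : StrongDual 𝕜 M) j < δ := by
    intro φ
    simpa using hcov φ.2
  choose r hr using hj
  have hne : Nonempty t := ⟨r ⟨0, by simp⟩⟩
  let inc : t → Metric.closedBall (0 : StrongDual 𝕜 M) 1 := fun j => ⟨j, hts j.2⟩
  let J : M →L[𝕜] lp (fun _ : t => 𝕜) ∞ := (linftyComp 𝕜 inc).comp (evalEmbeddingL 𝕜 M)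
  let R : lp (fun _ : t => 𝕜) ∞ →L[𝕜] LinftyDualBall 𝕜 M := linftyComp 𝕜 r
  let v := TensorProduct.map J.toLinearMap (LinearMap.id : N →ₗ[𝕜] N) z
  obtain ⟨W, hWv, hW⟩ := hd.exists_dual_vector v
  obtain ⟨μ, T', hμ, hT', hfac⟩ := exists_factorization_of_le_chevetSapharD (q := q) hp W hW
  refine ⟨∑ j, ((μ j : 𝕜) • (j : StrongDual 𝕜 M)) ⊗ₜ[𝕜] T' j, ?_, ?_⟩
  · refine (chevetSapharG_le (p := p) zero_le_one zero_le_one rfl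
      (hμ.mono zero_le_one le_rfl fun j => ?_) hT').trans (mul_one 1).le
    have hj : ‖(j : StrongDual 𝕜 M)‖ ≤ 1 := mem_closedBall_zero_iff.1 (hts j.2)
    rw [norm_smul, RCLike.norm_ofReal, ← Real.norm_eq_abs]
    exact mul_le_of_le_one_right (norm_nonneg _) hj
  · have hpair : tensorPairing 𝕜 M N z (∑ j, ((μ j : 𝕜) • (j : StrongDual 𝕜 M)) ⊗ₜ[𝕜] T' j) =
        (chevetSapharD 𝕜 p _ N v : 𝕜) := by
      rw [← hWv, hfac, tensorPairing_sum_tmul]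
      refine Finset.sum_congr rfl fun j _ => ?_
      rw [leftSlice_smul, map_smul, smul_eq_mul, leftSlice_map]
      rfl
    rw [hpair, RCLike.norm_ofReal, abs_of_nonneg (hd.nonneg v)]
    have hnorm : ‖evalEmbeddingL 𝕜 M - R.comp J‖ ≤ δ := by
      refine ContinuousLinearMap.opNorm_le_bound _ hδ.le fun x =>
        lp.norm_le_of_forall_le (by positivity) fun φ => ?_
      change ‖(φ : StrongDual 𝕜 M) x - (r φ : StrongDual 𝕜 M) x‖ ≤ δ * ‖x‖
      rw [← sub_apply]
      refine ContinuousLinearMap.le_of_opNorm_le _ ?_ x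
      rw [← dist_eq_norm]
      exact (hr φ).le
    have hsplit : TensorProduct.map (evalEmbedding 𝕜 M) (LinearMap.id : N →ₗ[𝕜] N) z =
        TensorProduct.map R.toLinearMap LinearMap.id v +
          TensorProduct.map (evalEmbeddingL 𝕜 M - R.comp J).toLinearMap
            (ContinuousLinearMap.id 𝕜 N).toLinearMap z := by
      have e : evalEmbedding 𝕜 M =
          R.toLinearMap ∘ₗ J.toLinearMap + (evalEmbeddingL 𝕜 M - R.comp J).toLinearMap := by
        rw [← toLinearMap_evalEmbeddingL]
        ext x : 1
        simp
      conv_lhs => rw [e, TensorProduct.map_add_left, LinearMap.add_apply]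
      congr 1
      simp only [v, ← LinearMap.comp_apply, ← TensorProduct.map_comp, LinearMap.id_comp]
    rw [leftInjectiveAssociate, hsplit]
    refine (hd.add_le _ _ _ _).trans (add_le_add (hd.map_id_le R (norm_linftyComp_le r) v) ?_)
    refine (hd.map_le _ _ _ _ _ _ z).trans (mul_le_mul_of_nonneg_right ?_ (hd.nonneg z))
    calc _ ≤ δ * 1 := mul_le_mul hnorm ContinuousLinearMap.norm_id_le (norm_nonneg _) hδ.le
      _ = δ := mul_one δ

theorem leftInjectiveAssociate_chevetSapharD_eq_traceDual {M N : Type u} [NormedAddCommGroup M]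
    [NormedSpace 𝕜 M] [FiniteDimensional 𝕜 M] [NormedAddCommGroup N] [NormedSpace 𝕜 N]
    (hp : p ≠ ∞) (z : M ⊗[𝕜] N) :
    leftInjectiveAssociate (chevetSapharD 𝕜 p) M N z = traceDual (chevetSapharG 𝕜 q) M N z := by
  have hp1 := ENNReal.HolderConjugate.one_le p q
  have hd := isTensorNorm_chevetSapharD.{u} (𝕜 := 𝕜) hp1
  have hub : ∀ c ∈ {c : ℝ | ∃ w : StrongDual 𝕜 M ⊗[𝕜] StrongDual 𝕜 N,
      chevetSapharG 𝕜 q (StrongDual 𝕜 M) (StrongDual 𝕜 N) w ≤ 1 ∧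
        c = ‖tensorPairing 𝕜 M N z w‖}, c ≤ leftInjectiveAssociate (chevetSapharD 𝕜 p) M N z := by
    rintro _ ⟨w, hw, rfl⟩
    refine le_of_forall_gt_imp_ge_of_dense fun s hs => ?_
    have hs0 : 0 < s := (chevetSapharD_nonneg hp1 _).trans_lt hs
    rw [← mul_one s, ← div_le_iff₀' hs0]
    refine le_of_forall_gt_imp_ge_of_dense fun t ht => ?_
    rw [div_le_iff₀' hs0]
    exact norm_tensorPairing_le_mul z w hs (hw.trans_lt ht)
  refine le_antisymm ?_ (csSup_le ?_ hub)
  · refine le_of_forall_pos_le_add fun ε hε => ?_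
    have h0 := hd.nonneg z
    have hδ : 0 < ε / (chevetSapharD 𝕜 p M N z + 1) := by positivity
    obtain ⟨w, hw, hle⟩ := exists_tensorPairing_ge (q := q) hp z hδ
    refine hle.trans (add_le_add (le_csSup ⟨_, hub⟩ ⟨w, hw, rfl⟩) ?_)
    rw [div_mul_eq_mul_div, div_le_iff₀ (by positivity)]
    nlinarith
  · obtain ⟨w, hw, -⟩ := exists_tensorPairing_ge (q := q) hp z one_pos
    exact ⟨_, w, hw, rfl⟩

theorem leftInjectiveAssociate_chevetSapharD_eq_dualTensorNorm {E F : Type u}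
    [NormedAddCommGroup E] [NormedSpace 𝕜 E] [NormedAddCommGroup F] [NormedSpace 𝕜 F]
    (hp : p ≠ ∞) (z : E ⊗[𝕜] F) :
    leftInjectiveAssociate (chevetSapharD 𝕜 p) E F z =
      dualTensorNorm (chevetSapharG 𝕜 q) E F z := by
  have hp1 := ENNReal.HolderConjugate.one_le p q
  rw [isFinitelyGenerated_leftInjectiveAssociate_chevetSapharD hp1 E F z, dualTensorNorm,
    finiteHull, finiteHull]
  congr 1
  ext c
  refine exists_congr fun M => exists_congr fun N => exists_congr fun w =>
    and_congr_right fun hM => ?_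
  rw [leftInjectiveAssociate_chevetSapharD_eq_traceDual (q := q) hp w]

end Equality

/-! ### The ideal of `p`-compact operators -/

section PCompact

variable {𝕜 : Type} [RCLike 𝕜] {p q : ℝ≥0∞} [hpq : p.HolderConjugate q]
  {D E F G : Type u} [NormedAddCommGroup D] [NormedSpace 𝕜 D] [NormedAddCommGroup E]
  [NormedSpace 𝕜 E] [NormedAddCommGroup F] [NormedSpace 𝕜 F] [NormedAddCommGroup G]
  [NormedSpace 𝕜 G] {ι κ : Type*}

/-- The operator `T` maps the unit ball into the set of sums `∑ c_i y_i` with coefficients of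
`ℓ_q` norm at most `A`, which tend to zero if `q = ∞`. The index type is arbitrary and `A` need
not be one, which makes it easy to concatenate and rescale. -/
def BallCoveredBy (q : ℝ≥0∞) (A : ℝ) (T : E →L[𝕜] F) (y : ι → F) : Prop :=
  ∀ x : E, ‖x‖ ≤ 1 → ∃ c : ι → 𝕜, LpBound q A c ∧
    (q = ∞ → Filter.Tendsto c Filter.cofinite (𝓝 0)) ∧ HasSum (fun i => c i • y i) (T x)

theorem BallCoveredBy.smul_smul {A r : ℝ} {T : E →L[𝕜] F} {y : ι → F} (hA : 0 ≤ A) (hr : 0 < r)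
    (h : BallCoveredBy q A T y) : BallCoveredBy q (r * A) T fun i => (r : 𝕜)⁻¹ • y i := by
  have hr' : (r : 𝕜) ≠ 0 := by simpa using hr.ne'
  intro x hx
  obtain ⟨c, h1, h2, h3⟩ := h x hx
  refine ⟨fun i => (r : 𝕜) * c i, h1.mul_left hA hr.le fun i => ?_, fun hq => ?_, ?_⟩
  · rw [norm_mul, RCLike.norm_ofReal, abs_of_pos hr]
  · simpa using (h2 hq).const_mul (r : 𝕜)
  · refine h3.congr_fun fun i => ?_
    change ((r : 𝕜) * c i) • (r : 𝕜)⁻¹ • y i = c i • y i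
    rw [mul_comm, mul_smul, smul_inv_smul₀ hr']

theorem tendsto_cofinite_extend {e : ι → κ} (he : Function.Injective e) {c : ι → 𝕜}
    (hc : Filter.Tendsto c Filter.cofinite (𝓝 0)) :
    Filter.Tendsto (Function.extend e c 0) Filter.cofinite (𝓝 0) := by
  intro U hU
  have hfin : (c ⁻¹' U)ᶜ.Finite := hc hU
  refine (hfin.image e).subset fun k hk => ?_
  by_cases hk' : ∃ i, e i = k
  · obtain ⟨i, rfl⟩ := hk'
    refine ⟨i, fun hi => hk ?_, rfl⟩
    change Function.extend e c 0 (e i) ∈ U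
    rwa [he.extend_apply]
  · refine absurd ?_ hk
    change Function.extend e c 0 k ∈ U
    rw [Function.extend_apply' _ _ _ hk']
    exact mem_of_mem_nhds hU

omit hpq in
theorem kappa_nonneg (T : E →L[𝕜] F) : 0 ≤ kappa 𝕜 p E F T := by
  refine Real.sInf_nonneg ?_
  rintro _ ⟨x, -, rfl⟩
  exact lp.norm_nonneg' x

theorem BallCoveredBy.mem_and_kappa_le_of_one [Countable ι] {B : ℝ} {T : E →L[𝕜] F} {y : ι → F}
    (hB : 0 ≤ B) (h : BallCoveredBy q 1 T y) (hy : LpBound p B y) :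
    T ∈ pCompactOperators 𝕜 p E F ∧ kappa 𝕜 p E F T ≤ B := by
  have hp1 := ENNReal.HolderConjugate.one_le p q
  have hq1 := ENNReal.HolderConjugate.one_le q p
  obtain rfl := ENNReal.HolderConjugate.conjExponent_eq (p := p) (q := q)
  obtain ⟨e, he⟩ := exists_injective_nat ι
  obtain ⟨Y, hY, hYB⟩ := (hy.extend hp1 hB he).exists_lp hp1 hB
  have hsub : T '' Metric.closedBall (0 : E) 1 ⊆ pConvexHull 𝕜 p Y := by
    rintro _ ⟨x, hx, rfl⟩
    obtain ⟨c, h1, h2, h3⟩ := h x (mem_closedBall_zero_iff.1 hx)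
    obtain ⟨C, hC, hC1⟩ := (h1.extend hq1 zero_le_one he).exists_lp hq1 zero_le_one
    refine ⟨C, hC1, fun hp => ?_, ?_⟩
    · subst hp
      have := tendsto_cofinite_extend he (h2 (by simp [ENNReal.conjExponent]))
      rw [Nat.cofinite_eq_atTop] at this
      exact this.congr fun n => (hC n).symm
    · rw [← he.hasSum_iff]
      · refine h3.congr_fun fun i => ?_
        simp only [Function.comp_apply, hC, hY, he.extend_apply]
      · intro n hn
        rw [hC, Function.extend_apply' _ _ _ (by simpa using hn), Pi.zero_apply, zero_smul]
  have hbdd : BddBelow {c : ℝ | ∃ x : lp (fun _ : ℕ => F) p,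
      T '' Metric.closedBall (0 : E) 1 ⊆ pConvexHull 𝕜 p x ∧ c = ‖x‖} := by
    refine ⟨0, ?_⟩
    rintro _ ⟨x, -, rfl⟩
    exact lp.norm_nonneg' x
  exact ⟨⟨Y, hsub⟩, (csInf_le hbdd ⟨Y, hsub, rfl⟩).trans hYB⟩

theorem BallCoveredBy.mem_and_kappa_le [Countable ι] {A B : ℝ} {T : E →L[𝕜] F} {y : ι → F}
    (hA : 0 ≤ A) (hB : 0 ≤ B) (h : BallCoveredBy q A T y) (hy : LpBound p B y) :
    T ∈ pCompactOperators 𝕜 p E F ∧ kappa 𝕜 p E F T ≤ A * B := by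
  have hq1 := ENNReal.HolderConjugate.one_le q p
  refine BallCoveredBy.mem_and_kappa_le_of_one (q := q) (y := fun i => (A : 𝕜) • y i)
    (mul_nonneg hA hB) ?_ (hy.mul_left hB hA fun i => ?_)
  · rcases hA.eq_or_lt with rfl | hA'
    · intro x hx
      obtain ⟨c, h1, h2, h3⟩ := h x hx
      refine ⟨c, h1.mono le_rfl zero_le_one fun _ => le_rfl, h2, h3.congr_fun fun i => ?_⟩
      have : c i = 0 := norm_le_zero_iff.1 (h1.norm_le hq1 le_rfl i)
      simp [this]
    · have := h.smul_smul hA (inv_pos.2 hA')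
      rw [inv_mul_cancel₀ hA'.ne'] at this
      simpa using this
  · rw [norm_smul, RCLike.norm_ofReal, abs_of_nonneg hA]

theorem exists_ballCoveredBy_of_kappa_lt {T : E →L[𝕜] F} (hT : T ∈ pCompactOperators 𝕜 p E F)
    {t : ℝ} (ht : kappa 𝕜 p E F T < t) :
    ∃ y : ℕ → F, LpBound p t y ∧ BallCoveredBy q 1 T y := by
  have hp1 := ENNReal.HolderConjugate.one_le p q
  have hq1 := ENNReal.HolderConjugate.one_le q p
  obtain rfl := ENNReal.HolderConjugate.conjExponent_eq (p := p) (q := q)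
  obtain ⟨Y₀, hY₀⟩ := hT
  have hne : Set.Nonempty {c : ℝ | ∃ x : lp (fun _ : ℕ => F) p,
      T '' Metric.closedBall (0 : E) 1 ⊆ pConvexHull 𝕜 p x ∧ c = ‖x‖} := ⟨_, Y₀, hY₀, rfl⟩
  obtain ⟨_, ⟨Y, hY, rfl⟩, hlt⟩ := exists_lt_of_csInf_lt hne ht
  refine ⟨Y, (lpBound_norm_lp hp1 Y).mono (lp.norm_nonneg' Y) hlt.le fun _ => le_rfl,
    fun x hx => ?_⟩
  obtain ⟨c, h1, h2, h3⟩ := hY ⟨x, mem_closedBall_zero_iff.2 hx, rfl⟩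
  refine ⟨c, (lpBound_norm_lp hq1 c).mono (lp.norm_nonneg' c) h1 fun _ => le_rfl, fun hq => ?_, h3⟩
  rw [Nat.cofinite_eq_atTop]
  exact h2 ((ENNReal.HolderConjugate.eq_top_iff_eq_one _ p).1 hq)

theorem norm_le_of_hasSum_smul {A B : ℝ} (hA : 0 ≤ A) (hB : 0 ≤ B) {c : ι → 𝕜} {y : ι → F} {v : F}
    (hc : LpBound q A c) (hy : LpBound p B y) (h : HasSum (fun i => c i • y i) v) :
    ‖v‖ ≤ A * B := by
  refine le_of_tendsto h.norm (Filter.Eventually.of_forall fun s => ?_)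
  refine (norm_sum_le _ _).trans (le_trans (le_of_eq ?_) (hc.sum_mul_le (q := p) hA hB hy s))
  exact Finset.sum_congr rfl fun i _ => norm_smul _ _

theorem BallCoveredBy.opNorm_le {A B : ℝ} {T : E →L[𝕜] F} {y : ι → F} (hA : 0 ≤ A) (hB : 0 ≤ B)
    (h : BallCoveredBy q A T y) (hy : LpBound p B y) : ‖T‖ ≤ A * B := by
  refine opNorm_le_of_forall_norm_le_one (mul_nonneg hA hB) fun x hx => ?_
  obtain ⟨c, h1, -, h3⟩ := h x hx
  exact norm_le_of_hasSum_smul hA hB h1 hy h3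

include hpq in
theorem opNorm_le_kappa {T : E →L[𝕜] F} (hT : T ∈ pCompactOperators 𝕜 p E F) :
    ‖T‖ ≤ kappa 𝕜 p E F T := by
  refine le_of_forall_gt_imp_ge_of_dense fun t ht => ?_
  obtain ⟨y, hy, hc⟩ := exists_ballCoveredBy_of_kappa_lt (q := q) hT ht
  simpa using hc.opNorm_le zero_le_one ((kappa_nonneg T).trans ht.le) hy

include hpq in
theorem smulRight_mem_pCompactOperators (φ : StrongDual 𝕜 E) (y : F) :
    φ.smulRight y ∈ pCompactOperators 𝕜 p E F ∧
      kappa 𝕜 p E F (φ.smulRight y) = ‖φ‖ * ‖y‖ := by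
  have hp1 := ENNReal.HolderConjugate.one_le p q
  have hq1 := ENNReal.HolderConjugate.one_le q p
  have hc : BallCoveredBy q ‖φ‖ (φ.smulRight y) (fun _ : Unit => y) := fun x hx => by
    refine ⟨fun _ => φ x, (lpBound_unit hq1 (φ x)).mono (norm_nonneg _) ?_ fun _ => le_rfl,
      fun _ => by simp, by simp⟩
    exact φ.unit_le_opNorm x hx
  obtain ⟨h1, h2⟩ := hc.mem_and_kappa_le (norm_nonneg _) (norm_nonneg _) (lpBound_unit hp1 y)
  refine ⟨h1, le_antisymm h2 ?_⟩
  rw [← ContinuousLinearMap.norm_smulRight_apply]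
  exact opNorm_le_kappa (q := q) h1

theorem BallCoveredBy.sumElim {s t : ℝ} (hs : 0 ≤ s) (ht : 0 ≤ t) {S T : E →L[𝕜] F} {y : ι → F}
    {z : κ → F} (hq1 : 1 ≤ q) (hS : BallCoveredBy q (s ^ q.toReal⁻¹) S y)
    (hT : BallCoveredBy q (t ^ q.toReal⁻¹) T z) :
    BallCoveredBy q ((s + t) ^ q.toReal⁻¹) (S + T) (Sum.elim y z) := by
  intro x hx
  obtain ⟨c, c1, c2, c3⟩ := hS x hx
  obtain ⟨d, d1, d2, d3⟩ := hT x hx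
  refine ⟨Sum.elim c d, c1.sumElim hq1 hs ht d1, fun hq U hU => ?_, ?_⟩
  · have hc : (c ⁻¹' U)ᶜ.Finite := c2 hq hU
    have hd : (d ⁻¹' U)ᶜ.Finite := d2 hq hU
    refine ((hc.image Sum.inl).union (hd.image Sum.inr)).subset ?_
    rintro (i | i) hi
    · exact Or.inl ⟨i, hi, rfl⟩
    · exact Or.inr ⟨i, hi, rfl⟩
  · exact HasSum.sum (f := fun i => Sum.elim c d i • Sum.elim y z i) c3 d3

theorem BallCoveredBy.rescale {t : ℝ} (ht : 0 < t) {T : E →L[𝕜] F} {y : ι → F}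
    (hy : LpBound p t y) (h : BallCoveredBy q 1 T y) :
    ∃ z : ι → F, LpBound p (t ^ p.toReal⁻¹) z ∧ BallCoveredBy q (t ^ q.toReal⁻¹) T z := by
  have hq : 0 < t ^ q.toReal⁻¹ := Real.rpow_pos_of_pos ht _
  refine ⟨_, ?_, by simpa using h.smul_smul zero_le_one hq⟩
  have := hy.mul_left ht.le (D := (t ^ q.toReal⁻¹)⁻¹)
    (g := fun i => ((t ^ q.toReal⁻¹ : ℝ) : 𝕜)⁻¹ • y i) (by positivity) fun i => by
      rw [norm_smul, norm_inv, RCLike.norm_ofReal, abs_of_pos hq]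
  convert this using 1
  rw [eq_inv_mul_iff_mul_eq₀ hq.ne', rpow_toReal_inv_mul_rpow p q ht]

include hpq in
theorem add_mem_pCompactOperators {S T : E →L[𝕜] F} (hS : S ∈ pCompactOperators 𝕜 p E F)
    (hT : T ∈ pCompactOperators 𝕜 p E F) : S + T ∈ pCompactOperators 𝕜 p E F ∧
      kappa 𝕜 p E F (S + T) ≤ kappa 𝕜 p E F S + kappa 𝕜 p E F T := by
  have hp1 := ENNReal.HolderConjugate.one_le p q
  have hq1 := ENNReal.HolderConjugate.one_le q p
  have key : ∀ ε, 0 < ε → S + T ∈ pCompactOperators 𝕜 p E F ∧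
      kappa 𝕜 p E F (S + T) ≤ kappa 𝕜 p E F S + kappa 𝕜 p E F T + ε := by
    intro ε hε
    have hs : 0 < kappa 𝕜 p E F S + ε / 2 := by
      have := kappa_nonneg (p := p) S; positivity
    have ht : 0 < kappa 𝕜 p E F T + ε / 2 := by
      have := kappa_nonneg (p := p) T; positivity
    obtain ⟨y, hy, hSy⟩ := exists_ballCoveredBy_of_kappa_lt (q := q) hS
      (show _ < kappa 𝕜 p E F S + ε / 2 by linarith)
    obtain ⟨z, hz, hTz⟩ := exists_ballCoveredBy_of_kappa_lt (q := q) hT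
      (show _ < kappa 𝕜 p E F T + ε / 2 by linarith)
    obtain ⟨y', hy', hSy'⟩ := hSy.rescale hs hy
    obtain ⟨z', hz', hTz'⟩ := hTz.rescale ht hz
    have h := (hSy'.sumElim hs.le ht.le hq1 hTz').mem_and_kappa_le (by positivity) (by positivity)
      (hy'.sumElim hp1 hs.le ht.le hz')
    rw [rpow_toReal_inv_mul_rpow p q (add_pos hs ht)] at h
    exact ⟨h.1, h.2.trans (by linarith)⟩
  exact ⟨(key 1 one_pos).1, le_of_forall_pos_le_add fun ε hε => (key ε hε).2⟩

include hpq in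
theorem comp_mem_pCompactOperators (R : D →L[𝕜] E) {T : E →L[𝕜] F} (S : F →L[𝕜] G)
    (hT : T ∈ pCompactOperators 𝕜 p E F) :
    S.comp (T.comp R) ∈ pCompactOperators 𝕜 p D G ∧
      kappa 𝕜 p D G (S.comp (T.comp R)) ≤ ‖S‖ * kappa 𝕜 p E F T * ‖R‖ := by
  have key : ∀ t, kappa 𝕜 p E F T < t → S.comp (T.comp R) ∈ pCompactOperators 𝕜 p D G ∧
      kappa 𝕜 p D G (S.comp (T.comp R)) ≤ ‖R‖ * ‖S‖ * t := by
    intro t ht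
    have ht0 : 0 ≤ t := (kappa_nonneg T).trans ht.le
    obtain ⟨y, hy, hTy⟩ := exists_ballCoveredBy_of_kappa_lt (q := q) hT ht
    have hc : BallCoveredBy q ‖R‖ (S.comp (T.comp R)) fun n => S (y n) := by
      intro x hx
      obtain ⟨c, h1, h2, h3⟩ := hTy ((‖R‖ : 𝕜)⁻¹ • R x) (by
        rw [norm_smul, norm_inv, RCLike.norm_ofReal, abs_norm]
        exact inv_mul_le_one_of_le₀ (R.unit_le_opNorm x hx) (norm_nonneg _))
      refine ⟨fun n => (‖R‖ : 𝕜) * c n, ?_, fun hq => by simpa using (h2 hq).const_mul _, ?_⟩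
      · simpa using h1.mul_left (g := fun n => (‖R‖ : 𝕜) * c n) zero_le_one (norm_nonneg R)
          fun n => by simp
      · have h4 := (S.hasSum h3).const_smul (‖R‖ : 𝕜)
        have e : (‖R‖ : 𝕜) • S (T ((‖R‖ : 𝕜)⁻¹ • R x)) = S (T (R x)) := by
          rcases eq_or_ne R 0 with rfl | hR
          · simp
          · rw [map_smul, map_smul, smul_inv_smul₀ (by simpa using hR)]
        rw [e] at h4
        refine h4.congr_fun fun n => ?_
        rw [map_smul, mul_smul]
    have := hc.mem_and_kappa_le (norm_nonneg _) (by positivity)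
      (hy.mul_left ht0 (norm_nonneg S) fun n => S.le_opNorm _)
    rwa [← mul_assoc] at this
  refine ⟨(key (kappa 𝕜 p E F T + 1) (by linarith)).1, ?_⟩
  rw [mul_right_comm, mul_comm ‖S‖]
  exact le_mul_of_forall_gt fun t ht => (key t ht).2

include hpq in
theorem smul_mem_pCompactOperators (c : 𝕜) {T : E →L[𝕜] F}
    (hT : T ∈ pCompactOperators 𝕜 p E F) : c • T ∈ pCompactOperators 𝕜 p E F ∧
      kappa 𝕜 p E F (c • T) = ‖c‖ * kappa 𝕜 p E F T := by
  have key : ∀ (c : 𝕜) {T : E →L[𝕜] F}, T ∈ pCompactOperators 𝕜 p E F →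
      c • T ∈ pCompactOperators 𝕜 p E F ∧ kappa 𝕜 p E F (c • T) ≤ ‖c‖ * kappa 𝕜 p E F T := by
    intro c T hT
    have h0 := kappa_nonneg (p := p) T
    have h := comp_mem_pCompactOperators (q := q) (ContinuousLinearMap.id 𝕜 E)
      (c • ContinuousLinearMap.id 𝕜 F) hT
    have e : (c • ContinuousLinearMap.id 𝕜 F).comp (T.comp (ContinuousLinearMap.id 𝕜 E)) =
        c • T := by ext x; simp
    rw [e] at h
    refine ⟨h.1, h.2.trans ?_⟩
    calc _ ≤ ‖c‖ * kappa 𝕜 p E F T * 1 := by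
          refine mul_le_mul (mul_le_mul_of_nonneg_right ?_ h0) ContinuousLinearMap.norm_id_le
            (norm_nonneg _) (by positivity)
          rw [norm_smul]
          exact mul_le_of_le_one_right (norm_nonneg c) ContinuousLinearMap.norm_id_le
      _ = _ := mul_one _
  refine ⟨(key c hT).1, le_antisymm (key c hT).2 ?_⟩
  rcases eq_or_ne c 0 with rfl | hc
  · simpa using kappa_nonneg (p := p) (0 : E →L[𝕜] F)
  · have := (key c⁻¹ (key c hT).1).2
    rw [inv_smul_smul₀ hc, norm_inv] at this
    rwa [← le_inv_mul_iff₀ (by simpa using hc)]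

include hpq in
theorem sub_mem_pCompactOperators {S T : E →L[𝕜] F} (hS : S ∈ pCompactOperators 𝕜 p E F)
    (hT : T ∈ pCompactOperators 𝕜 p E F) : S - T ∈ pCompactOperators 𝕜 p E F := by
  have := (add_mem_pCompactOperators (q := q) hS
    (smul_mem_pCompactOperators (q := q) (-1 : 𝕜) hT).1).1
  rwa [neg_one_smul, ← sub_eq_add_neg] at this

include hpq in
theorem kappa_sub_comm {S T : E →L[𝕜] F} (h : S - T ∈ pCompactOperators 𝕜 p E F) :
    kappa 𝕜 p E F (T - S) = kappa 𝕜 p E F (S - T) := by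
  have := (smul_mem_pCompactOperators (q := q) (-1 : 𝕜) h).2
  rwa [neg_one_smul, neg_sub, norm_neg, norm_one, one_mul] at this

theorem lpBound_geometric {r : ℝ≥0∞} (hr : 1 ≤ r) :
    LpBound r 1 fun n : ℕ => (1 / 2 / 2 ^ n : ℝ) := by
  have h0 : ∀ n : ℕ, (0 : ℝ) ≤ 1 / 2 / 2 ^ n := fun n => by positivity
  have hS := hasSum_geometric_two' 1
  have h1 : ∀ n : ℕ, (1 / 2 / 2 ^ n : ℝ) ≤ 1 := fun n => le_hasSum hS n fun j _ => h0 j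
  refine ⟨fun _ n => ?_, fun h s => ?_⟩
  · rw [Real.norm_of_nonneg (h0 n)]
    exact h1 n
  · rw [Real.one_rpow]
    refine le_trans (Finset.sum_le_sum fun n _ => ?_) (sum_le_hasSum s (fun n _ => h0 n) hS)
    rw [Real.norm_of_nonneg (h0 n)]
    exact Real.rpow_le_self_of_le_one (h0 n) (h1 n) (one_le_toReal_of_one_le hr h)

theorem tendsto_cofinite_geometric_mul {c : ℕ → ℕ → 𝕜} (hc1 : ∀ j k, ‖c j k‖ ≤ 1)
    (hc : ∀ j, Filter.Tendsto (c j) Filter.cofinite (𝓝 0)) :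
    Filter.Tendsto (fun x : ℕ × ℕ => ((1 / 2 / 2 ^ x.1 : ℝ) : 𝕜) * c x.1 x.2) Filter.cofinite
      (𝓝 0) := by
  have hS := hasSum_geometric_two' 1
  have h0 : ∀ n : ℕ, (0 : ℝ) ≤ 1 / 2 / 2 ^ n := fun n => by positivity
  have h1 : ∀ n : ℕ, (1 / 2 / 2 ^ n : ℝ) ≤ 1 := fun n => le_hasSum hS n fun j _ => h0 j
  rw [Metric.tendsto_nhds]
  intro δ hδ
  have hA : {j : ℕ | ¬ (1 / 2 / 2 ^ j : ℝ) < δ}.Finite :=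
    hS.summable.tendsto_cofinite_zero.eventually_lt_const hδ
  have hB : ∀ j, {k : ℕ | ¬ dist (c j k) 0 < δ}.Finite := fun j =>
    Metric.tendsto_nhds.1 (hc j) δ hδ
  refine (hA.biUnion fun j _ => (hB j).image (Prod.mk j)).subset ?_
  rintro ⟨j, k⟩ hjk
  have hjk' : δ ≤ 1 / 2 / 2 ^ j * ‖c j k‖ := by
    have : ¬ dist (((1 / 2 / 2 ^ j : ℝ) : 𝕜) * c j k) 0 < δ := hjk
    rwa [dist_zero_right, norm_mul, RCLike.norm_ofReal, abs_of_nonneg (h0 j), not_lt] at this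
  simp only [Set.mem_iUnion]
  refine ⟨j, not_lt.2 (hjk'.trans (mul_le_of_le_one_right (h0 j) (hc1 j k))), k, ?_, rfl⟩
  refine not_lt.2 ?_
  rw [dist_zero_right]
  exact hjk'.trans (mul_le_of_le_one_left (norm_nonneg _) (h1 j))

include hpq in
/-- A pointwise convergent series of `p`-compact operators with rapidly decreasing norms is
`p`-compact. The coefficients of the `j`-th operator are multiplied by `2^{-(j+1)}`, which keeps
them in the unit ball of `ℓ_q`, and in `c_0` if `q = ∞`; the vectors are divided by this factor. -/
theorem mem_pCompactOperators_of_series [CompleteSpace F] {U : ℕ → E →L[𝕜] F} {V : E →L[𝕜] F}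
    {ε : ℝ} (hε : 0 < ε) (hU : ∀ j, U j ∈ pCompactOperators 𝕜 p E F)
    (hκ : ∀ j, kappa 𝕜 p E F (U j) < ε * (1 / 2 / 2 ^ j) ^ 2)
    (hV : ∀ x, Filter.Tendsto (fun n => ∑ j ∈ Finset.range n, U j x) Filter.atTop (𝓝 (V x))) :
    V ∈ pCompactOperators 𝕜 p E F ∧ kappa 𝕜 p E F V ≤ ε := by
  have hp1 := ENNReal.HolderConjugate.one_le p q
  have hq1 := ENNReal.HolderConjugate.one_le q p
  choose y hy hUy using fun j => exists_ballCoveredBy_of_kappa_lt (q := q) (hU j) (hκ j)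
  let g : ℕ → ℝ := fun j => 1 / 2 / 2 ^ j
  have hg : ∀ j, 0 < g j := fun j => by positivity
  have hg' : ∀ j, (g j : 𝕜) ≠ 0 := fun j => by simpa using (hg j).ne'
  let Y : ℕ × ℕ → F := fun x => (g x.1 : 𝕜)⁻¹ • y x.1 x.2
  have hY : LpBound p ε Y := by
    have h := LpBound.prod (r := p) (f := Y) (g := g)
      (h := fun j k => ((g j : 𝕜)⁻¹ ^ 2) • y j k) zero_le_one hε.le (lpBound_geometric hp1)
      (fun j => ?_) (fun j k => ?_)
    · rwa [one_mul] at h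
    · have := (hy j).mul_left (g := fun k => ((g j : 𝕜)⁻¹ ^ 2) • y j k) (D := (g j)⁻¹ ^ 2)
        (by positivity) (by positivity) fun k => by
          rw [norm_smul, norm_pow, norm_inv, RCLike.norm_ofReal, abs_of_pos (hg j)]
      convert this using 1
      change ε = (g j)⁻¹ ^ 2 * (ε * g j ^ 2)
      have := (hg j).ne'
      field_simp
    · rw [norm_smul, norm_smul, norm_pow, norm_inv, RCLike.norm_ofReal, abs_of_pos (hg j),
        Real.norm_of_nonneg (hg j).le]
      have := (hg j).ne'
      refine le_of_eq ?_
      field_simp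
  suffices hc : BallCoveredBy q 1 V Y from hc.mem_and_kappa_le_of_one hε.le hY
  intro x hx
  choose c c1 c2 c3 using fun j => hUy j x hx
  let C : ℕ × ℕ → 𝕜 := fun i => (g i.1 : 𝕜) * c i.1 i.2
  have hC : LpBound q 1 C := by
    have h := LpBound.prod (r := q) (f := C) (g := g) zero_le_one zero_le_one
      (lpBound_geometric hq1) c1 (fun j k => by simp [C])
    rwa [one_mul] at h
  refine ⟨C, hC, fun hq => ?_, ?_⟩
  · exact tendsto_cofinite_geometric_mul (fun j k => (c1 j).norm_le hq1 zero_le_one k)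
      fun j => c2 j hq
  · have hsum : Summable fun i => C i • Y i := by
      refine Summable.of_norm (summable_of_sum_le (c := 1 * ε) (fun _ => norm_nonneg _) fun s => ?_)
      simp_rw [norm_smul]
      exact hC.sum_mul_le (q := p) zero_le_one hε.le hY s
    have hfib : ∀ j, HasSum (fun k => C (j, k) • Y (j, k)) (U j x) := fun j => by
      refine (c3 j).congr_fun fun k => ?_
      change ((g j : 𝕜) * c j k) • (g j : 𝕜)⁻¹ • y j k = c j k • y j k
      rw [mul_comm, mul_smul, smul_inv_smul₀ (hg' j)]
    have h := (hsum.hasSum.prod_fiberwise hfib).tendsto_sum_nat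
    rw [← tendsto_nhds_unique h (hV x)]
    exact hsum.hasSum

include hpq in
theorem pCompactOperators_complete [CompleteSpace F] {T : ℕ → E →L[𝕜] F}
    (hT : ∀ n, T n ∈ pCompactOperators 𝕜 p E F)
    (hC : ∀ ε : ℝ, 0 < ε → ∃ k : ℕ, ∀ m n : ℕ, k ≤ m → k ≤ n → kappa 𝕜 p E F (T m - T n) < ε) :
    ∃ T₀ ∈ pCompactOperators 𝕜 p E F,
      Filter.Tendsto (fun n => kappa 𝕜 p E F (T n - T₀)) Filter.atTop (𝓝 0) := by
  have hcauchy : CauchySeq T := by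
    refine Metric.cauchySeq_iff.2 fun ε hε => ?_
    obtain ⟨k, hk⟩ := hC ε hε
    refine ⟨k, fun m hm n hn => ?_⟩
    rw [dist_eq_norm]
    exact (opNorm_le_kappa (q := q) (sub_mem_pCompactOperators (q := q) (hT m) (hT n))).trans_lt
      (hk m n hm hn)
  obtain ⟨T₀, hT₀⟩ := cauchySeq_tendsto_of_complete hcauchy
  have key : ∀ ε : ℝ, 0 < ε → ∃ k : ℕ, ∀ n, k ≤ n →
      T₀ - T n ∈ pCompactOperators 𝕜 p E F ∧ kappa 𝕜 p E F (T₀ - T n) ≤ ε := by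
    intro ε hε
    choose K hK using fun j : ℕ => hC (ε * (1 / 2 / 2 ^ j) ^ 2) (by positivity)
    refine ⟨K 0, fun n hn => ?_⟩
    -- a subsequence starting at `n` along which consecutive differences decrease rapidly
    let idx : ℕ → ℕ := fun j => n + ∑ i ∈ Finset.range j, (K (i + 1) + 1)
    have hstep : ∀ j, idx (j + 1) = idx j + (K (j + 1) + 1) := fun j => by
      simp only [idx, Finset.sum_range_succ, add_assoc]
    have hidxK : ∀ j, K j ≤ idx j := by
      intro j
      cases j with
      | zero => simpa [idx] using hn
      | succ j => rw [hstep]; omega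
    have hmono : StrictMono idx := strictMono_nat_of_lt_succ fun j => by rw [hstep]; omega
    refine mem_pCompactOperators_of_series (q := q) (U := fun j => T (idx (j + 1)) - T (idx j)) hε
      (fun j => sub_mem_pCompactOperators (q := q) (hT _) (hT _)) (fun j => hK j _ _
        ((hidxK j).trans (hmono.monotone j.le_succ)) (hidxK j)) fun x => ?_
    have e : ∀ m, ∑ j ∈ Finset.range m, (T (idx (j + 1)) - T (idx j)) x = T (idx m) x - T n x := by
      intro m
      have := Finset.sum_range_sub (fun j => T (idx j) x) m
      simpa [idx] using this
    simp_rw [e]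
    have := (ContinuousLinearMap.apply 𝕜 F x).continuous.tendsto T₀
    exact ((this.comp hT₀).comp hmono.tendsto_atTop).sub_const _
  obtain ⟨k, hk⟩ := key 1 one_pos
  refine ⟨T₀, ?_, ?_⟩
  · have := (add_mem_pCompactOperators (q := q) (hk k le_rfl).1 (hT k)).1
    rwa [sub_add_cancel] at this
  · refine Metric.tendsto_atTop.2 fun ε hε => ?_
    obtain ⟨k, hk⟩ := key (ε / 2) (by positivity)
    refine ⟨k, fun n hn => ?_⟩
    rw [Real.dist_0_eq_abs, abs_of_nonneg (kappa_nonneg _),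
      kappa_sub_comm (q := q) (hk n hn).1]
    linarith [(hk n hn).2]

theorem isBanachOperatorIdeal_pCompactOperators (𝕜 : Type) [RCLike 𝕜] {p : ℝ≥0∞} (hp : 1 ≤ p) :
    IsBanachOperatorIdeal.{u} (pCompactOperators 𝕜 p) (kappa 𝕜 p) :=
  have _hpq := ENNReal.HolderConjugate.conjExponent hp
  { rank_one := fun _ _ _ _ _ _ _ _ φ y =>
      smulRight_mem_pCompactOperators (q := ENNReal.conjExponent p) φ y
    add_mem := fun _ _ _ _ _ _ _ _ _ _ hS hT =>
      add_mem_pCompactOperators (q := ENNReal.conjExponent p) hS hT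
    smul_mem := fun _ _ _ _ _ _ _ _ c _ hT =>
      smul_mem_pCompactOperators (q := ENNReal.conjExponent p) c hT
    eq_zero := fun _ _ _ _ _ _ _ _ _ hT h0 => norm_le_zero_iff.1
      (h0 ▸ opNorm_le_kappa (q := ENNReal.conjExponent p) hT)
    comp_mem := fun _ _ _ _ _ _ _ _ _ _ _ _ _ _ _ _ R _ S hT =>
      comp_mem_pCompactOperators (q := ENNReal.conjExponent p) R S hT
    complete := fun _ _ _ _ _ _ _ _ _ hT hC =>
      pCompactOperators_complete (q := ENNReal.conjExponent p) hT hC }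

end PCompact

/-! ### Association of `(K_p, κ_p)` with `/d_p` -/

section Associated

variable {𝕜 : Type} [RCLike 𝕜]

theorem finrank_strongDual (V : Type u) [NormedAddCommGroup V] [NormedSpace 𝕜 V]
    [FiniteDimensional 𝕜 V] : Module.finrank 𝕜 (StrongDual 𝕜 V) = Module.finrank 𝕜 V := by
  rw [← (LinearMap.toContinuousLinearMap : (V →ₗ[𝕜] 𝕜) ≃ₗ[𝕜] StrongDual 𝕜 V).finrank_eq]
  exact Subspace.dual_finrank_eq

theorem norm_inclusionInDoubleDual {V : Type u} [NormedAddCommGroup V] [NormedSpace 𝕜 V] (x : V) :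
    ‖NormedSpace.inclusionInDoubleDual 𝕜 V x‖ = ‖x‖ :=
  (NormedSpace.inclusionInDoubleDualLi 𝕜).norm_map x

/-- Finite-dimensional spaces are reflexive. -/
theorem inclusionInDoubleDual_surjective (V : Type u) [NormedAddCommGroup V] [NormedSpace 𝕜 V]
    [FiniteDimensional 𝕜 V] : Function.Surjective (NormedSpace.inclusionInDoubleDual 𝕜 V) := by
  have e : Module.finrank 𝕜 V = Module.finrank 𝕜 (StrongDual 𝕜 (StrongDual 𝕜 V)) := by
    rw [finrank_strongDual, finrank_strongDual]
  have h : Function.Surjective (NormedSpace.inclusionInDoubleDualLi 𝕜 (E := V)) :=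
    ((NormedSpace.inclusionInDoubleDualLi 𝕜 (E := V)).toLinearIsometryEquiv e).surjective
  exact fun φ => h φ

section

variable {E F : Type u} [NormedAddCommGroup E] [NormedSpace 𝕜 E]
  [NormedAddCommGroup F] [NormedSpace 𝕜 F]

theorem IsTensorNorm.sum_tmul_le {α : TensorFamily.{u} 𝕜} (hα : IsTensorNorm α) {ι : Type*}
    (s : Finset ι) (x : ι → E) (y : ι → F) :
    α E F (∑ i ∈ s, x i ⊗ₜ[𝕜] y i) ≤ ∑ i ∈ s, ‖x i‖ * ‖y i‖ := by
  classical
  induction s using Finset.induction_on with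
  | empty => simpa using (hα.smul_eq E F 0 0).le
  | insert i s hi ih =>
    rw [Finset.sum_insert hi, Finset.sum_insert hi]
    exact (hα.add_le E F _ _).trans (add_le_add (hα.tmul_le E F _ _) ih)

/-- On `ℓ_∞(S) ⊗ N` with `N` finite-dimensional every tensor norm is dominated by a multiple of
the supremum norm of the associated `N`-valued function. -/
theorem IsTensorNorm.exists_le_mul_of_leftSlice_le {α : TensorFamily.{u} 𝕜} (hα : IsTensorNorm α)
    (N : Type u) [NormedAddCommGroup N] [NormedSpace 𝕜 N] [FiniteDimensional 𝕜 N] :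
    ∃ K : ℝ, 0 ≤ K ∧ ∀ (S : Type u) (v : lp (fun _ : S => 𝕜) ∞ ⊗[𝕜] N) (τ : ℝ), 0 ≤ τ →
      (∀ s, ‖leftSlice N (linftyEval s) v‖ ≤ τ) → α _ N v ≤ K * τ := by
  let b := Module.finBasis 𝕜 N
  let ψ : Fin (Module.finrank 𝕜 N) → StrongDual 𝕜 N := fun k =>
    LinearMap.toContinuousLinearMap (b.coord k)
  refine ⟨∑ k, ‖ψ k‖ * ‖b k‖, by positivity, fun S v τ hτ hv => ?_⟩
  -- the coordinates of `v` with respect to the basis `b` of the right factor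
  let β : Fin (Module.finrank 𝕜 N) →
      lp (fun _ : S => 𝕜) ∞ ⊗[𝕜] N →ₗ[𝕜] lp (fun _ : S => 𝕜) ∞ := fun k =>
    (TensorProduct.rid 𝕜 _).toLinearMap ∘ₗ TensorProduct.map LinearMap.id (b.coord k)
  have hβ : v = ∑ k, β k v ⊗ₜ[𝕜] b k := by
    clear hv
    induction v with
    | zero => simp
    | tmul f y =>
      conv_lhs => rw [← b.sum_repr y, TensorProduct.tmul_sum]
      refine Finset.sum_congr rfl fun k _ => ?_
      simp [β, TensorProduct.smul_tmul]
    | add v w hv hw =>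
      simp only [map_add, TensorProduct.add_tmul, Finset.sum_add_distrib]
      rw [← hv, ← hw]
  have hβs : ∀ k s, β k v s = ψ k (leftSlice N (linftyEval s) v) := by
    intro k s
    clear hv hβ
    rw [← linftyEval_apply]
    induction v with
    | zero => simp
    | tmul f y => simp [β, ψ, mul_comm]
    | add v w hv hw => simp only [map_add, hv, hw]
  rw [hβ, Finset.sum_mul]
  refine (hα.sum_tmul_le _ _ _).trans (Finset.sum_le_sum fun k _ => ?_)
  rw [mul_right_comm]
  refine mul_le_mul_of_nonneg_right (lp.norm_le_of_forall_le (by positivity) fun s => ?_)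
    (norm_nonneg _)
  rw [hβs]
  exact (ψ k).le_opNorm_of_le (hv s)

@[simp]
theorem tensorToOperator_tmul (φ : StrongDual 𝕜 E) (y : F) :
    tensorToOperator 𝕜 E F (φ ⊗ₜ[𝕜] y) = φ.smulRight y := rfl

theorem leftSlice_inclusionInDoubleDual (x : E) (z : StrongDual 𝕜 E ⊗[𝕜] F) :
    leftSlice F (NormedSpace.inclusionInDoubleDual 𝕜 E x) z = tensorToOperator 𝕜 E F z x := by
  induction z with
  | zero => simp
  | tmul φ y => simp
  | add z w hz hw => simp only [map_add, hz, hw, add_apply]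

theorem mem_dualBall_iff {φ : StrongDual 𝕜 E} :
    φ ∈ Metric.closedBall (0 : StrongDual 𝕜 E) 1 ↔ ‖φ‖ ≤ 1 := mem_closedBall_zero_iff

theorem tensorToOperator_bijective (M N : Type u) [NormedAddCommGroup M] [NormedSpace 𝕜 M]
    [FiniteDimensional 𝕜 M] [NormedAddCommGroup N] [NormedSpace 𝕜 N] [FiniteDimensional 𝕜 N] :
    Function.Bijective (tensorToOperator 𝕜 M N) := by
  refine ⟨(injective_iff_map_eq_zero _).2 fun z hz => eq_zero_of_leftSlice z fun φ => ?_,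
    fun T => ?_⟩
  · obtain ⟨x, rfl⟩ := inclusionInDoubleDual_surjective M φ
    rw [leftSlice_inclusionInDoubleDual, hz, zero_apply]
  · let b := Module.finBasis 𝕜 N
    refine ⟨∑ k, ((LinearMap.toContinuousLinearMap (b.coord k)).comp T) ⊗ₜ[𝕜] b k, ?_⟩
    ext x
    rw [map_sum]
    simp [b.sum_repr]

end

variable {p q : ℝ≥0∞} [hpq : p.HolderConjugate q]

include hpq in
theorem tensorToOperator_mem_pCompactOperators {E F : Type u} [NormedAddCommGroup E]
    [NormedSpace 𝕜 E] [NormedAddCommGroup F] [NormedSpace 𝕜 F] (z : StrongDual 𝕜 E ⊗[𝕜] F) :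
    tensorToOperator 𝕜 E F z ∈ pCompactOperators 𝕜 p E F := by
  induction z with
  | zero => simpa using (smulRight_mem_pCompactOperators (q := q) (0 : StrongDual 𝕜 E) (0 : F)).1
  | tmul φ y => exact (smulRight_mem_pCompactOperators (q := q) φ y).1
  | add z w hz hw =>
    rw [map_add]
    exact (add_mem_pCompactOperators (q := q) hz hw).1

include hpq in
/-- A representation of a tensor in `ℓ_∞(B_{E''}) ⊗ F` covers the image of the unit ball under the
corresponding operator. -/
theorem kappa_tensorToOperator_le {E F : Type u} [NormedAddCommGroup E] [NormedSpace 𝕜 E]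
    [NormedAddCommGroup F] [NormedSpace 𝕜 F] (z : StrongDual 𝕜 E ⊗[𝕜] F) :
    kappa 𝕜 p E F (tensorToOperator 𝕜 E F z) ≤
      leftInjectiveAssociate (chevetSapharD 𝕜 p) (StrongDual 𝕜 E) F z := by
  have hp1 := ENNReal.HolderConjugate.one_le p q
  refine le_of_forall_gt_imp_ge_of_dense fun t ht => ?_
  have ht0 : 0 < t := (chevetSapharD_nonneg hp1 _).trans_lt ht
  obtain ⟨n, x, y, hz, hx, hy⟩ := exists_rep_of_chevetSapharD_lt (q := q) ht
  have hc : BallCoveredBy q (t ^ q.toReal⁻¹) (tensorToOperator 𝕜 E F z) y := by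
    intro m hm
    let θ : Metric.closedBall (0 : StrongDual 𝕜 (StrongDual 𝕜 E)) 1 :=
      ⟨NormedSpace.inclusionInDoubleDual 𝕜 E m, mem_dualBall_iff.2
        ((NormedSpace.double_dual_bound 𝕜 E m).trans hm)⟩
    refine ⟨fun i => x i θ, hx (linftyEval θ) (norm_linftyEval_le θ), fun _ => by simp, ?_⟩
    have h := leftSlice_linftyEval_map_evalEmbedding θ z
    rw [hz, leftSlice_sum_tmul] at h
    rw [← leftSlice_inclusionInDoubleDual, ← h]
    exact hasSum_fintype _
  refine (hc.mem_and_kappa_le (by positivity) (by positivity) hy).2.trans ?_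
  rw [rpow_toReal_inv_mul_rpow p q ht0]

theorem LpBound.exists_tail {F : Type*} [NormedAddCommGroup F] {r : ℝ≥0∞} (hr' : r ≠ ∞)
    {C η : ℝ} (hη : 0 < η) {y : ℕ → F} (hy : LpBound r C y) :
    ∃ n : ℕ, LpBound r η fun i => y (i + n) := by
  have hs : Summable fun i => ‖y i‖ ^ r.toReal :=
    summable_of_sum_le (fun _ => by positivity) ((lpBound_of_ne_top hr').1 hy)
  have h0 : 0 < η ^ r.toReal := by positivity
  obtain ⟨n, hn⟩ := ((tendsto_sum_nat_add fun i => ‖y i‖ ^ r.toReal).eventually_lt_const h0).exists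
  refine ⟨n, (lpBound_of_ne_top hr').2 fun s => le_trans ?_ hn.le⟩
  exact ((summable_nat_add_iff n).2 hs).sum_le_tsum s fun _ _ => by positivity

/-- If the `N`-valued function on `S` given by a tensor in `ℓ_∞(S) ⊗ N` takes its values in the
`p`-convex hull of `y`, then `d_p` of the tensor is at most the norm of `y`. The coefficients are
bounded functions on `S`, so cutting `y` off gives a representation up to an error which is
uniformly small on `S`, and such an error is small for `d_p` because `N` is finite-dimensional. -/
theorem chevetSapharD_le_of_hasSum {S N : Type u} [NormedAddCommGroup N] [NormedSpace 𝕜 N]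
    [FiniteDimensional 𝕜 N] (hp : p ≠ ∞) (Z : lp (fun _ : S => 𝕜) ∞ ⊗[𝕜] N) {t : ℝ} (ht : 0 ≤ t)
    {y : ℕ → N} (hy : LpBound p t y) {c : S → ℕ → 𝕜} (hc : ∀ s, LpBound q 1 (c s))
    (hZ : ∀ s, HasSum (fun i => c s i • y i) (leftSlice N (linftyEval s) Z)) :
    chevetSapharD 𝕜 p _ N Z ≤ t := by
  have hp1 := ENNReal.HolderConjugate.one_le p q
  have hq1 := ENNReal.HolderConjugate.one_le q p
  have hd := isTensorNorm_chevetSapharD.{u} (𝕜 := 𝕜) hp1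
  obtain ⟨K, hK0, hK⟩ := hd.exists_le_mul_of_leftSlice_le N
  have key : ∀ η, 0 < η → chevetSapharD 𝕜 p _ N Z ≤ t + K * η := by
    intro η hη
    obtain ⟨n, hn⟩ := hy.exists_tail hp hη
    let a : Fin n → lp (fun _ : S => 𝕜) ∞ := fun i =>
      ⟨fun s => c s i, memℓp_infty ⟨1, by
        rintro _ ⟨s, rfl⟩
        exact (hc s).norm_le hq1 zero_le_one i⟩⟩
    have h1 : chevetSapharD 𝕜 p _ N (∑ i, a i ⊗ₜ[𝕜] y i) ≤ 1 * t :=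
      chevetSapharD_le (q := q) zero_le_one ht rfl
        (WeakBound.of_forall_apply (p := p) zero_le_one fun s =>
          (hc s).comp_injective (e := Fin.val) Fin.val_injective)
        (hy.comp_injective (e := Fin.val) Fin.val_injective)
    have h2 : chevetSapharD 𝕜 p _ N (Z - ∑ i, a i ⊗ₜ[𝕜] y i) ≤ K * η := by
      refine hK _ _ η hη.le fun s => ?_
      rw [map_sub, leftSlice_sum_tmul]
      have htail := (hasSum_nat_add_iff' n).2 (hZ s)
      rw [Finset.sum_range] at htail
      have := norm_le_of_hasSum_smul zero_le_one hη.le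
        ((hc s).comp_injective (e := fun i => i + n) (add_left_injective n)) hn htail
      rwa [one_mul] at this
    have h3 := hd.add_le _ _ (∑ i, a i ⊗ₜ[𝕜] y i) (Z - ∑ i, a i ⊗ₜ[𝕜] y i)
    rw [add_sub_cancel] at h3
    rw [one_mul] at h1
    exact h3.trans (add_le_add h1 h2)
  refine le_of_forall_pos_le_add fun ε hε => (key (ε / (K + 1)) (by positivity)).trans ?_
  gcongr
  rw [← mul_div_assoc, div_le_iff₀ (by positivity)]
  nlinarith

/-- By reflexivity the points of `B_{M''}` are the evaluations at points of `B_M`. -/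
theorem exists_leftSlice_eq_apply {M N : Type u} [NormedAddCommGroup M] [NormedSpace 𝕜 M]
    [FiniteDimensional 𝕜 M] [NormedAddCommGroup N] [NormedSpace 𝕜 N]
    (φ : StrongDual 𝕜 (StrongDual 𝕜 M)) (hφ : ‖φ‖ ≤ 1) :
    ∃ m : M, ‖m‖ ≤ 1 ∧ ∀ z : StrongDual 𝕜 M ⊗[𝕜] N,
      leftSlice N φ z = tensorToOperator 𝕜 M N z m := by
  obtain ⟨m, rfl⟩ := inclusionInDoubleDual_surjective M φ
  exact ⟨m, norm_inclusionInDoubleDual (𝕜 := 𝕜) m ▸ hφ,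
    fun z => leftSlice_inclusionInDoubleDual m z⟩

set_option maxHeartbeats 400000 in
include hpq in
theorem le_kappa_tensorToOperator {M N : Type u} [NormedAddCommGroup M] [NormedSpace 𝕜 M]
    [FiniteDimensional 𝕜 M] [NormedAddCommGroup N] [NormedSpace 𝕜 N] [FiniteDimensional 𝕜 N]
    (hp : p ≠ ∞) (z : StrongDual 𝕜 M ⊗[𝕜] N) :
    leftInjectiveAssociate (chevetSapharD 𝕜 p) (StrongDual 𝕜 M) N z ≤
      kappa 𝕜 p M N (tensorToOperator 𝕜 M N z) := by
  refine le_of_forall_gt_imp_ge_of_dense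
    (a₁ := leftInjectiveAssociate (chevetSapharD 𝕜 p) (StrongDual 𝕜 M) N z)
    (a₂ := kappa 𝕜 p M N (tensorToOperator 𝕜 M N z)) fun t ht => ?_
  have ht0 : 0 ≤ t := (kappa_nonneg _).trans ht.le
  obtain ⟨y, hy, hcov⟩ := exists_ballCoveredBy_of_kappa_lt (q := q)
    (tensorToOperator_mem_pCompactOperators (q := q) z) ht
  have hval : ∀ φ : Metric.closedBall (0 : StrongDual 𝕜 (StrongDual 𝕜 M)) 1, ∃ c : ℕ → 𝕜,
      LpBound q 1 c ∧ HasSum (fun i => c i • y i) (leftSlice N (linftyEval φ)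
        (TensorProduct.map (evalEmbedding 𝕜 (StrongDual 𝕜 M)) LinearMap.id z)) := by
    intro φ
    obtain ⟨m, hm1, hm⟩ := exists_leftSlice_eq_apply (N := N)
      (φ : StrongDual 𝕜 (StrongDual 𝕜 M)) (mem_dualBall_iff.1 φ.2)
    obtain ⟨c, hc1, -, hc⟩ := hcov m hm1
    rw [leftSlice_linftyEval_map_evalEmbedding, hm]
    exact ⟨c, hc1, hc⟩
  choose c hc1 hc using hval
  rw [leftInjectiveAssociate]
  exact chevetSapharD_le_of_hasSum (q := q) hp _ ht0 hy hc1 hc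

theorem isAssociated_pCompactOperators (𝕜 : Type) [RCLike 𝕜] {p : ℝ≥0∞} (hp : 1 ≤ p)
    (hp_top : p ≠ ∞) : IsAssociated.{u} (pCompactOperators 𝕜 p) (kappa 𝕜 p)
      (leftInjectiveAssociate (chevetSapharD 𝕜 p)) := by
  intro M N _ _ _ _ _ _
  have hpq := ENNReal.HolderConjugate.conjExponent hp
  have hbij := tensorToOperator_bijective (𝕜 := 𝕜) M N
  refine ⟨⟨fun z _ => tensorToOperator_mem_pCompactOperators (q := ENNReal.conjExponent p) z,
    hbij.injective.injOn, fun T _ => ?_⟩, fun z => le_antisymm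
      (kappa_tensorToOperator_le (q := ENNReal.conjExponent p) z)
      (le_kappa_tensorToOperator (q := ENNReal.conjExponent p) hp_top z)⟩
  obtain ⟨z, hz⟩ := hbij.surjective T
  exact ⟨z, Set.mem_univ z, hz⟩

end Associated

theorem theorem3p3 (𝕜 : Type) [RCLike 𝕜] (p : ℝ≥0∞) (hp : 1 ≤ p) (hp_top : p ≠ ∞) :
    IsBanachOperatorIdeal.{u} (pCompactOperators 𝕜 p) (kappa 𝕜 p) ∧
    IsLeftInjectiveAssociate.{u} (leftInjectiveAssociate (chevetSapharD 𝕜 p))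
      (chevetSapharD 𝕜 p) ∧
    IsFinitelyGenerated.{u} (leftInjectiveAssociate (chevetSapharD 𝕜 p)) ∧
    IsAssociated.{u} (pCompactOperators 𝕜 p) (kappa 𝕜 p)
      (leftInjectiveAssociate (chevetSapharD 𝕜 p)) ∧
    ∀ (E F : Type u) [NormedAddCommGroup E] [NormedSpace 𝕜 E]
      [NormedAddCommGroup F] [NormedSpace 𝕜 F] (z : E ⊗[𝕜] F),
      leftInjectiveAssociate (chevetSapharD 𝕜 p) E F z =
        dualTensorNorm (chevetSapharG 𝕜 (ENNReal.conjExponent p)) E F z := by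
  have hpq := ENNReal.HolderConjugate.conjExponent hp
  exact ⟨isBanachOperatorIdeal_pCompactOperators 𝕜 hp,
    isLeftInjectiveAssociate_leftInjectiveAssociate (isTensorNorm_chevetSapharD hp),
    isFinitelyGenerated_leftInjectiveAssociate_chevetSapharD hp,
    isAssociated_pCompactOperators 𝕜 hp hp_top,
    fun _ _ _ _ _ _ z => leftInjectiveAssociate_chevetSapharD_eq_dualTensorNorm hp_top z⟩
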